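/- **Setting.** A weighted graph $(G,\mu)$ is an infinite, locally finite, connected graph $G=(V,E_G)$ with a symmetric function $\mu:V\times V\to[0,\infty)$ such that $\mu(x,y)>0$ if and only if $x\sim y$. Put $\mu_x=\sum_y\mu(x,y)$, $B_G(x,r)=\{y: d_G(x,y)\le r\}$ ($d_G$ the graph distance) and $V_G(x,r)=\sum_{y\in B_G(x,r)}\mu_y$. Consider the following conditions, with constants $p_0>0$, $C_V>1$, $C_P>1$: - $(p_0)$: $\mu(x,y)\ge p_0\,\mu_x$ whenever $x\sim y$; - $V(d_f)$: $C_V^{-1}r^{d_f}\le V_G(x,r)\le C_V r^{d_f}$ for all $x\in V$, $r\ge1$; - $\mathrm{PI}(d_w)$: for all $x_0\in V$, $r\ge0$ and $f:V\to\mathbb R$, with $B=B_G(x_0,r)$ and $f_B=V_G(x_0,r)^{-1}\sum_{x\in B}f(x)\mu_x$, $$\sum_{x\in B}(f(x)-f_B)^2\mu_x\le C_P\,r^{d_w}\sum_{x,y\in B_G(x_0,2r),\,x\sim y}(f(x)-f(y))^2\mu(x,y).$$ The cable system $\mathcal X$ of $(G,\mu)$ is obtained by replacing each edge $e$ by a copy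 $\gamma_e:[0,1]\to\mathcal X$ of the unit interval and gluing these at the vertices. It carries the maximal metric $d$ with $d(\gamma_e(s),\gamma_e(t))\le|s-t|$ for all $e,s,t$, with open balls $B(x,r)$, and the Borel measure $m$ that is $\mu(v,w)$ times Lebesgue measure on the edge $\{v,w\}$. Put $|\nabla f|(\gamma_e(s))=|(f\circ\gamma_e)'(s)|$. Let $\mathcal F\subset L^2(m)$ be the completion of the compactly supported Lipschitz functions for the norm $\big(\int|\nabla f|^2dm+\int f^2dm\big)^{1/2}$. For an open set $D\subset\mathcal X$ let $\mathcal F(D)$ be the set of $u\in L^2_{\rm loc}(D,m)$ that agree $m$-a.e. on each open $\Omega$ with compact closure in $D$ with some element of $\mathcal F$, and satisfy $\int_D u^2dm+\int_D|\nabla u|^2dm<\infty$; such a $u$ has a unique representative that is continuous on $D$, and $u$ denotes this representative. The Hausdorff $s$-content of $A\subset\mathcal X$ is $\mathcal H^\infty_s(A)=\inf\sum_i r_i^s$, over all countable covers of $A$ by balls of radii $r_i>0$. **Proposition.** Let $d_f,d_w,s\in\mathbb R$ with $d_w\le d_f+1$ and $d_f-d_w<s\le d_f$, and let $\lambda>0$,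 $p_0>0$, $C_V>1$, $C_P>1$. Then there is a constant $C>1$, depending only on $s,d_f,d_w,\lambda,p_0,C_V,C_P$, such that the following holds for every weighted graph $(G,\mu)$ that satisfies $(p_0)$, $V(d_f)$ and $\mathrm{PI}(d_w)$ with these constants. Let $x\in\mathcal X$ and $r>0$, and let $E,F\subset B(x,r)$ be disjoint sets with $$\min\big(\mathcal H^\infty_s(E),\mathcal H^\infty_s(F)\big)\ge\lambda r^s.$$ Then every $u\in\mathcal F(B(x,9r))$ with $u=1$ on $E$ and $u=0$ on $F$ satisfies $$\int_{B(x,9r)}|\nabla u|^2\,dm\ge C^{-1}r^{d_f-d_w}.$$ -/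

import Mathlib

open MeasureTheory Filter Topology Set

universe u

noncomputable section

/-! ### Hausdorff content -/

/-- The Hausdorff `s`-content of `E`: the infimum of `∑ rᵢ ^ s` over all countable (finite or
infinite) covers of `E` by open balls `B(cᵢ, rᵢ)` of positive radius. -/
def hausdorffContent {X : Type*} [PseudoMetricSpace X] (s : ℝ) (E : Set X) : ENNReal :=
  ⨅ (I : Set ℕ) (c : ℕ → X) (ρ : ℕ → ℝ) (_ : ∀ i ∈ I, 0 < ρ i)
    (_ : E ⊆ ⋃ i ∈ I, Metric.ball (c i) (ρ i)), ∑' i : I, ENNReal.ofReal (ρ i ^ s)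

/-! ### Weighted graphs -/

/-- An infinite, locally finite, connected graph with symmetric nonnegative conductances that are
positive exactly on the edges. -/
structure WeightedGraph (V : Type u) where
  graph : SimpleGraph V
  infinite : Infinite V
  locallyFinite : ∀ v, (graph.neighborSet v).Finite
  connected : graph.Connected
  weight : V → V → ℝ
  weight_nonneg : ∀ x y, 0 ≤ weight x y
  weight_symm : ∀ x y, weight x y = weight y x
  weight_pos_iff : ∀ x y, 0 < weight x y ↔ graph.Adj x y

namespace WeightedGraph

variable {V : Type u} (W : WeightedGraph V)

/-- `μ_x = ∑_y μ(x,y)` (a finite sum, by local finiteness). -/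
def vertexWeight (x : V) : ℝ := ∑ᶠ y, W.weight x y

/-- The closed ball `B_G(x,r)` of the combinatorial graph metric (a finite set). -/
def graphBall (x : V) (r : ℝ) : Set V := {y | (W.graph.dist x y : ℝ) ≤ r}

/-- `V_G(x,r) = μ(B_G(x,r))`. -/
def graphVolume (x : V) (r : ℝ) : ℝ := ∑ᶠ y ∈ W.graphBall x r, W.vertexWeight y

/-- The condition `(p₀)`: `p(x,y) = μ(x,y)/μ_x ≥ p₀` whenever `x ∼ y`. -/
def SatisfiesP0 (p₀ : ℝ) : Prop :=
  ∀ x y, W.graph.Adj x y → p₀ ≤ W.weight x y / W.vertexWeight x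

/-- Polynomial volume growth `V(d_f)` with constant `C_V`. -/
def SatisfiesVolumeGrowth (df CV : ℝ) : Prop :=
  ∀ (x : V) (r : ℝ), 1 ≤ r →
    CV⁻¹ * r ^ df ≤ W.graphVolume x r ∧ W.graphVolume x r ≤ CV * r ^ df

/-- The mean `f_B` of `f` over the ball `B_G(x₀,r)` with respect to `μ`. -/
def graphMean (f : V → ℝ) (x₀ : V) (r : ℝ) : ℝ :=
  (∑ᶠ x ∈ W.graphBall x₀ r, f x * W.vertexWeight x) / W.graphVolume x₀ r

/-- The Poincaré inequality `PI(d_w)` with constant `C_P`. Since `μ(x,y) = 0` unless `x ∼ y`, the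
restriction `x ∼ y` in the sum on the right is automatic. -/
def SatisfiesPoincare (dw CP : ℝ) : Prop :=
  ∀ (x₀ : V) (r : ℝ), 0 ≤ r → ∀ f : V → ℝ,
    ∑ᶠ x ∈ W.graphBall x₀ r, (f x - W.graphMean f x₀ r) ^ 2 * W.vertexWeight x ≤
      CP * r ^ dw * ∑ᶠ x ∈ W.graphBall x₀ (2 * r), ∑ᶠ y ∈ W.graphBall x₀ (2 * r),
        (f x - f y) ^ 2 * W.weight x y

/-! ### The cable system as a metric space -/

/-- The (unoriented) edges. -/
abbrev Edge : Type u := W.graph.edgeSet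

variable {W}

/-- Source of an edge, for an arbitrarily chosen orientation. -/
def src (e : W.Edge) : V := (Quot.out e.1).1

/-- Target of an edge, for the same orientation. -/
def tgt (e : W.Edge) : V := (Quot.out e.1).2

theorem edge_eq (e : W.Edge) : e.1 = s(src e, tgt e) := (Quot.out_eq e.1).symm

theorem src_ne_tgt (e : W.Edge) : src e ≠ tgt e := by
  have h := e.2
  rw [edge_eq e, SimpleGraph.mem_edgeSet] at h
  exact h.ne

/-- The relation that generates the gluing of the endpoints of the unit intervals. -/
inductive Glue : W.Edge × unitInterval → W.Edge × unitInterval → Prop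
  | tgt_src (e e' : W.Edge) (h : tgt e = src e') : Glue (e, 1) (e', 0)
  | src_src (e e' : W.Edge) (h : src e = src e') : Glue (e, 0) (e', 0)
  | tgt_tgt (e e' : W.Edge) (h : tgt e = tgt e') : Glue (e, 1) (e', 1)

variable (W)

/-- The cable system: the quotient of `E × [0,1]` by the smallest equivalence relation that
contains `Glue`. -/
def Cable : Type u := Quot (Glue (W := W))

variable {W}

/-- The canonical map `q : E × [0,1] → 𝒳`. -/
def proj (p : W.Edge × unitInterval) : W.Cable := Quot.mk _ p

/-- A pseudometric `ρ` on the cable system with `ρ(q(e,s), q(e,t)) ≤ |s - t|`. -/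
structure IsAdmissible (ρ : W.Cable → W.Cable → ℝ) : Prop where
  self : ∀ x, ρ x x = 0
  symm : ∀ x y, ρ x y = ρ y x
  triangle : ∀ x y z, ρ x z ≤ ρ x y + ρ y z
  edge_le : ∀ (e : W.Edge) (s t : unitInterval), ρ (proj (e, s)) (proj (e, t)) ≤ |(s : ℝ) - t|

/-- The maximal admissible pseudometric (a metric, see the instance below). -/
def cableDist (x y : W.Cable) : ℝ :=
  sSup {a | ∃ ρ : W.Cable → W.Cable → ℝ, IsAdmissible ρ ∧ ρ x y = a}

theorem IsAdmissible.zero : IsAdmissible (fun _ _ : W.Cable => (0 : ℝ)) :=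
  ⟨fun _ => rfl, fun _ _ => rfl, fun _ _ _ => by simp, fun _ _ _ => abs_nonneg _⟩

theorem IsAdmissible.edge_le_one {ρ : W.Cable → W.Cable → ℝ} (h : IsAdmissible ρ) (e : W.Edge)
    (s t : unitInterval) : ρ (proj (e, s)) (proj (e, t)) ≤ 1 := by
  refine (h.edge_le e s t).trans ?_
  have := s.2.1; have := s.2.2; have := t.2.1; have := t.2.2
  rw [abs_le]; constructor <;> linarith

/-- `IsOver p v`: the point `p` is the vertex `v`. -/
def IsOver (p : W.Cable) (v : V) : Prop :=
  ∃ e : W.Edge, (p = proj (e, 0) ∧ src e = v) ∨ (p = proj (e, 1) ∧ tgt e = v)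

theorem IsOver.unique {p p' : W.Cable} {v : V} (h : IsOver p v) (h' : IsOver p' v) : p = p' := by
  obtain ⟨e, ⟨rfl, h⟩ | ⟨rfl, h⟩⟩ := h <;> obtain ⟨e', ⟨rfl, h'⟩ | ⟨rfl, h'⟩⟩ := h'
  · exact Quot.sound (Glue.src_src e e' (h.trans h'.symm))
  · exact (Quot.sound (Glue.tgt_src e' e (h'.trans h.symm))).symm
  · exact Quot.sound (Glue.tgt_src e e' (h.trans h'.symm))
  · exact Quot.sound (Glue.tgt_tgt e e' (h.trans h'.symm))

theorem exists_edge_of_adj {v w : V} (h : W.graph.Adj v w) :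
    ∃ (e : W.Edge) (s t : unitInterval), IsOver (proj (e, s)) v ∧ IsOver (proj (e, t)) w := by
  let e : W.Edge := ⟨s(v, w), h⟩
  have he : s(v, w) = s(src e, tgt e) := edge_eq e
  rcases Sym2.eq_iff.1 he with ⟨h1, h2⟩ | ⟨h1, h2⟩
  · exact ⟨e, 0, 1, ⟨e, Or.inl ⟨rfl, h1.symm⟩⟩, ⟨e, Or.inr ⟨rfl, h2.symm⟩⟩⟩
  · exact ⟨e, 1, 0, ⟨e, Or.inr ⟨rfl, h1.symm⟩⟩, ⟨e, Or.inl ⟨rfl, h2.symm⟩⟩⟩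

theorem IsAdmissible.le_of_walk {ρ : W.Cable → W.Cable → ℝ} (h : IsAdmissible ρ) {v w : V}
    (c : W.graph.Walk v w) : ∀ {p p' : W.Cable}, IsOver p v → IsOver p' w → ρ p p' ≤ c.length := by
  induction c with
  | nil => intro p p' hp hp'; simp [hp.unique hp', h.self]
  | cons hadj c ih =>
    intro p p' hp hp'
    obtain ⟨e, s, t, h1, h2⟩ := exists_edge_of_adj hadj
    rw [hp.unique h1]
    have := h.triangle (proj (e, s)) (proj (e, t)) p'
    have := h.edge_le_one e s t
    have := ih h2 hp'
    push_cast [SimpleGraph.Walk.length_cons]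
    linarith

theorem bddAbove_admissible (x y : W.Cable) :
    BddAbove {a | ∃ ρ : W.Cable → W.Cable → ℝ, IsAdmissible ρ ∧ ρ x y = a} := by
  obtain ⟨⟨e, s⟩, rfl⟩ := Quot.exists_rep x
  obtain ⟨⟨e', s'⟩, rfl⟩ := Quot.exists_rep y
  obtain ⟨c⟩ := W.connected.preconnected (src e) (src e')
  refine ⟨1 + (c.length + 1), ?_⟩
  rintro _ ⟨ρ, h, rfl⟩
  have h1 := h.le_of_walk c (p := proj (e, 0)) (p' := proj (e', 0))
    ⟨e, Or.inl ⟨rfl, rfl⟩⟩ ⟨e', Or.inl ⟨rfl, rfl⟩⟩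
  have h2 := h.edge_le_one e s 0
  have h3 := h.edge_le_one e' 0 s'
  have h4 := h.triangle (proj (e, s)) (proj (e, 0)) (proj (e', s'))
  have h5 := h.triangle (proj (e, 0)) (proj (e', 0)) (proj (e', s'))
  change ρ (proj (e, s)) (proj (e', s')) ≤ _
  linarith

/-- Every admissible pseudometric is bounded by `cableDist`. -/
theorem IsAdmissible.le_cableDist {ρ : W.Cable → W.Cable → ℝ} (h : IsAdmissible ρ)
    (x y : W.Cable) : ρ x y ≤ cableDist x y :=
  le_csSup (bddAbove_admissible x y) ⟨ρ, h, rfl⟩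

theorem cableDist_le {x y : W.Cable} {a : ℝ}
    (h : ∀ ρ : W.Cable → W.Cable → ℝ, IsAdmissible ρ → ρ x y ≤ a) : cableDist x y ≤ a :=
  csSup_le ⟨0, _, IsAdmissible.zero, rfl⟩ (by rintro _ ⟨ρ, hρ, rfl⟩; exact h ρ hρ)

/-- `cableDist` is itself admissible. -/
theorem isAdmissible_cableDist : IsAdmissible (cableDist (W := W)) where
  self x := le_antisymm (cableDist_le fun _ h => (h.self x).le) (IsAdmissible.zero.le_cableDist x x)
  symm x y := le_antisymm
    (cableDist_le fun _ h => h.symm x y ▸ h.le_cableDist y x)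
    (cableDist_le fun _ h => h.symm y x ▸ h.le_cableDist x y)
  triangle x y z := cableDist_le fun _ h =>
    (h.triangle x y z).trans (add_le_add (h.le_cableDist x y) (h.le_cableDist y z))
  edge_le e s t := cableDist_le fun _ h => h.edge_le e s t

theorem abs_sub_le_cableDist {f : W.Cable → ℝ}
    (hf : ∀ (e : W.Edge) (s t : unitInterval), |f (proj (e, s)) - f (proj (e, t))| ≤ |(s : ℝ) - t|)
    (x y : W.Cable) : |f x - f y| ≤ cableDist x y :=
  IsAdmissible.le_cableDist (ρ := fun x y => |f x - f y|)
    ⟨fun x => by simp, fun x y => abs_sub_comm _ _, fun x y z => abs_sub_le _ _ _, hf⟩ x y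

open Classical in
/-- A bump at the interior point `q(e₀,s₀)` of an edge, used to separate points. -/
def edgeBump (e₀ : W.Edge) (s₀ : unitInterval) : W.Cable → ℝ :=
  Quot.lift
    (fun p => if p.1 = e₀ then max 0 (min (s₀ : ℝ) (1 - s₀) - |(p.2 : ℝ) - s₀|) else 0) (by
      have h0 := s₀.2.1
      have h1 := s₀.2.2
      have ha : max 0 (min (s₀ : ℝ) (1 - s₀) - |(((0 : unitInterval) : ℝ)) - s₀|) = 0 := by
        apply max_eq_left
        rw [Set.Icc.coe_zero, zero_sub, abs_neg, abs_of_nonneg h0]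
        linarith [min_le_left (s₀ : ℝ) (1 - s₀)]
      have hb : max 0 (min (s₀ : ℝ) (1 - s₀) - |(((1 : unitInterval) : ℝ)) - s₀|) = 0 := by
        apply max_eq_left
        rw [Set.Icc.coe_one, abs_of_nonneg (by linarith)]
        linarith [min_le_right (s₀ : ℝ) (1 - s₀)]
      rintro _ _ (⟨e, e', h⟩ | ⟨e, e', h⟩ | ⟨e, e', h⟩) <;> simp only [ha, hb, ite_self])

open Classical in
/-- A tent at the vertex `v`, used to separate points. -/
def vertexBump (v : V) : W.Cable → ℝ :=
  Quot.lift
    (fun p => if src p.1 = v then 1 - (p.2 : ℝ) else if tgt p.1 = v then (p.2 : ℝ) else 0) (by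
      have hne : ∀ e : W.Edge, src e ≠ tgt e := src_ne_tgt
      rintro _ _ (⟨e, e', h⟩ | ⟨e, e', h⟩ | ⟨e, e', h⟩) <;>
        have h1 := hne e <;> have h2 := hne e' <;>
        simp only [Set.Icc.coe_zero, Set.Icc.coe_one] <;> split_ifs <;>
        simp_all)

theorem edgeBump_lip (e₀ : W.Edge) (s₀ : unitInterval) (e : W.Edge) (s t : unitInterval) :
    |edgeBump e₀ s₀ (proj (e, s)) - edgeBump e₀ s₀ (proj (e, t))| ≤ |(s : ℝ) - t| := by
  simp only [edgeBump, proj]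
  split_ifs
  · refine (abs_max_sub_max_le_max _ _ _ _).trans ?_
    rw [sub_self, abs_zero, max_eq_right (abs_nonneg _), sub_sub_sub_cancel_left]
    refine (abs_abs_sub_abs_le_abs_sub _ _).trans ?_
    rw [sub_sub_sub_cancel_right, abs_sub_comm]
  · simp

theorem vertexBump_lip (v : V) (e : W.Edge) (s t : unitInterval) :
    |vertexBump v (proj (e, s)) - vertexBump v (proj (e, t))| ≤ |(s : ℝ) - t| := by
  simp only [vertexBump, proj]
  split_ifs
  · rw [sub_sub_sub_cancel_left, abs_sub_comm]
  · exact le_rfl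
  · simp

theorem vertexBump_eq_one_iff (v : V) (y : W.Cable) : vertexBump v y = 1 ↔ IsOver y v := by
  constructor
  · obtain ⟨⟨e, t⟩, rfl⟩ := Quot.exists_rep y
    simp only [vertexBump]
    split_ifs with h1 h2
    · intro h
      have : t = 0 := Subtype.ext (by rw [Set.Icc.coe_zero]; linarith)
      exact ⟨e, Or.inl ⟨by rw [this]; rfl, h1⟩⟩
    · intro h
      have : t = 1 := Subtype.ext (by rw [Set.Icc.coe_one]; linarith)
      exact ⟨e, Or.inr ⟨by rw [this]; rfl, h2⟩⟩
    · intro h; norm_num at h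
  · rintro ⟨e, ⟨rfl, h⟩ | ⟨rfl, h⟩⟩
    · simp [vertexBump, proj, h]
    · have hne : src e ≠ v := h ▸ src_ne_tgt e
      simp [vertexBump, proj, h, hne]

theorem cableDist_eq_zero {x y : W.Cable} (h : cableDist x y = 0) : x = y := by
  have key : ∀ v : V, IsOver x v → x = y := by
    intro v hx
    have h1 := abs_sub_le_cableDist (vertexBump_lip (W := W) v) x y
    rw [h, (vertexBump_eq_one_iff v x).2 hx, abs_nonpos_iff, sub_eq_zero] at h1
    exact hx.unique ((vertexBump_eq_one_iff v y).1 h1.symm)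
  obtain ⟨⟨e, s⟩, rfl⟩ := Quot.exists_rep x
  by_cases h0 : s = 0
  · exact key (src e) ⟨e, Or.inl ⟨by rw [h0]; rfl, rfl⟩⟩
  by_cases h1 : s = 1
  · exact key (tgt e) ⟨e, Or.inr ⟨by rw [h1]; rfl, rfl⟩⟩
  have hs0 : 0 < (s : ℝ) := unitInterval.pos_iff_ne_zero.2 h0
  have hs1 : (s : ℝ) < 1 := unitInterval.lt_one_iff_ne_one.2 h1
  have hpos : 0 < min (s : ℝ) (1 - s) := lt_min hs0 (by linarith)
  have h2 := abs_sub_le_cableDist (edgeBump_lip (W := W) e s) (Quot.mk _ (e, s)) y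
  rw [h, abs_nonpos_iff, sub_eq_zero] at h2
  obtain ⟨⟨e', t⟩, rfl⟩ := Quot.exists_rep y
  simp only [edgeBump, if_true, sub_self, abs_zero, sub_zero, max_eq_right hpos.le] at h2
  split_ifs at h2 with h3
  · have h4 : |(t : ℝ) - s| ≤ 0 := by
      rcases max_cases 0 (min (s : ℝ) (1 - s) - |(t : ℝ) - s|) with h5 | h5 <;> linarith
    have h6 : t = s := Subtype.ext (by linarith [abs_nonpos_iff.1 h4])
    rw [h3, h6]
  · linarith

instance : MetricSpace W.Cable where
  dist := cableDist
  dist_self := isAdmissible_cableDist.self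
  dist_comm := isAdmissible_cableDist.symm
  dist_triangle := isAdmissible_cableDist.triangle
  eq_of_dist_eq_zero := cableDist_eq_zero

instance : MeasurableSpace W.Cable := borel W.Cable

instance : BorelSpace W.Cable := ⟨rfl⟩

/-! ### Measure, gradient and Dirichlet form -/

/-- The parametrization `γ_e : [0,1] → 𝒳`, extended to `ℝ` by constants. -/
def edgePath (e : W.Edge) (t : ℝ) : W.Cable := proj (e, projIcc 0 1 zero_le_one t)

variable (W) in
/-- The measure `m`: on the edge `e = {u,v}` it is `μ(u,v)` times the image of Lebesgue measure
on `[0,1]` under `γ_e`. -/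
def cableMeasure : Measure W.Cable :=
  Measure.sum fun e : W.Edge =>
    ENNReal.ofReal (W.weight (src e) (tgt e)) • (volume.restrict (Icc (0 : ℝ) 1)).map (edgePath e)

open Classical in
/-- `|∇f|`, given by `|∇f|(γ_e(s)) = |(f ∘ γ_e)'(s)|` for `0 < s < 1`, and set to `0` at the
vertices, which form a null set. -/
def gradNorm (f : W.Cable → ℝ) : W.Cable → ℝ :=
  Quot.lift
    (fun p => if p.2 = 0 ∨ p.2 = 1 then 0 else |deriv (fun t => f (edgePath p.1 t)) (p.2 : ℝ)|)
    (by rintro _ _ (⟨e, e', h⟩ | ⟨e, e', h⟩ | ⟨e, e', h⟩) <;> simp)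

/-- `∫_A |∇f|² dm`. -/
def energyOn (A : Set W.Cable) (f : W.Cable → ℝ) : ENNReal :=
  ∫⁻ x in A, ENNReal.ofReal (gradNorm f x ^ 2) ∂W.cableMeasure

/-- `∫_A f² dm`. -/
def massOn (A : Set W.Cable) (f : W.Cable → ℝ) : ENNReal :=
  ∫⁻ x in A, ENNReal.ofReal (f x ^ 2) ∂W.cableMeasure

/-- Compactly supported Lipschitz functions, the core of the Dirichlet form. -/
def IsCore (f : W.Cable → ℝ) : Prop :=
  HasCompactSupport f ∧ ∃ K, LipschitzWith K f

/-- The domain `𝓕` of the Dirichlet form, the completion of the core for the norm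
`(∫ |∇f|² dm + ∫ f² dm)^{1/2}`, realized in `L²(m)`: the `L²`-limits of sequences of core functions
that are Cauchy for this norm. -/
def IsInDomain (f : W.Cable → ℝ) : Prop :=
  MemLp f 2 W.cableMeasure ∧
  ∃ φ : ℕ → W.Cable → ℝ, (∀ n, IsCore (φ n)) ∧
    (∀ ε : ENNReal, 0 < ε → ∃ N, ∀ i ≥ N, ∀ j ≥ N,
      energyOn univ (φ i - φ j) + massOn univ (φ i - φ j) ≤ ε) ∧
    Tendsto (fun n => massOn univ (φ n - f)) atTop (𝓝 0)

/-- `𝓕_loc(D)`: locally square integrable functions on `D` that agree a.e. on each open `Ω` with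
compact closure in `D` with some element of `𝓕`. -/
def IsInLocalDomain (D : Set W.Cable) (u : W.Cable → ℝ) : Prop :=
  ∀ Ω : Set W.Cable, IsOpen Ω → IsCompact (closure Ω) → closure Ω ⊆ D →
    MemLp u 2 (W.cableMeasure.restrict Ω) ∧
    ∃ v : W.Cable → ℝ, IsInDomain v ∧ u =ᵐ[W.cableMeasure.restrict Ω] v

/-- `𝓕(D)`: the elements `u` of `𝓕_loc(D)` with `∫_D u² dm + ∫_D |∇u|² dm < ∞`. An element of
`𝓕_loc(D)` is an a.e. class that contains exactly one function continuous on `D`. It is represented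
by this function, which gives meaning to its values at points and to `|∇u|`; only the values of
`u` on `D` matter. -/
def IsInReflectedDomain (D : Set W.Cable) (u : W.Cable → ℝ) : Prop :=
  ContinuousOn u D ∧ IsInLocalDomain D u ∧ massOn D u + energyOn D u < ⊤

end WeightedGraph

end

/-! ### Functions of one real variable with square integrable derivative -/

/-! The proof is a chaining argument combined with a covering. Let M be the mean of u over a graph
ball of radius 3r around a vertex near x. Since u is 1 on E and 0 on F, one of the two sets, say A,
has |u - M| ≥ 1/2 at all its points.

For r ≥ 2 and y in A, let v be a vertex at distance at most 1 from y. Compare M with u(y) through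
the means over the graph balls around v of radii r, r/2, r/4, ..., until the ball is the single
point v, and then along the edge from v to y. By the Poincaré inequality and the volume bounds, the
squared increment at scale ρ is at most a constant times ρ^(dw-df) times the energy in B(y,4ρ). If
all these energies were below c(ρ/r)^s r^(df-dw) and the total energy below c r^(df-dw), the
increments would be dominated by a small multiple of a geometric series, convergent because s >
df-dw, and could not add up to 1/2. So either the total energy is large or every y in A has a ball
carrying much energy (`exists_energyOn_closedBall_ge`). In the second case a Vitali selection of
disjoint balls bounds the content of A by the total energy (`hausdorffContent_le_mul_measure_univ`,
`mul_rpow_le_energyOn`).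

For r ≤ 2, at most three pieces of edges join x to a point of B(x,r), and the one-dimensional energy
inequality suffices (`IsInReflectedDomain.abs_sub_le_of_dist_lt`).

Both cases need increments of u along an edge to be bounded by the integral of its squared pointwise
derivative. For this, u is shown to be absolutely continuous along edges, as a limit of Lipschitz
functions of bounded energy (`IsInReflectedDomain.sq_sub_le_lintegral`). Summed over edges, this
bounds the discrete energy in the Poincaré inequality by the cable energy (`graphEnergy_le`). -/

theorem sq_setLIntegral_le_volume_mul {S : Set ℝ} {g : ℝ → ENNReal} (hg : Measurable g) :
    (∫⁻ x in S, g x) ^ 2 ≤ volume S * ∫⁻ x in S, g x ^ 2 := by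
  have h := ENNReal.lintegral_mul_le_Lp_mul_Lq (volume.restrict S) Real.HolderConjugate.two_two
    (f := fun _ => 1) (g := g) aemeasurable_const hg.aemeasurable
  simp only [Pi.mul_apply, one_mul, ENNReal.one_rpow, lintegral_const, Measure.restrict_apply,
    MeasurableSet.univ, univ_inter] at h
  calc (∫⁻ x in S, g x) ^ 2
      ≤ (volume S ^ (1 / 2 : ℝ) * (∫⁻ x in S, g x ^ (2 : ℝ)) ^ (1 / 2 : ℝ)) ^ 2 := by gcongr
    _ = volume S * ∫⁻ x in S, g x ^ 2 := by
      rw [mul_pow, ← ENNReal.rpow_natCast, ← ENNReal.rpow_natCast, ← ENNReal.rpow_mul,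
        ← ENNReal.rpow_mul]
      norm_num

/-- The one-dimensional energy inequality for absolutely continuous functions. -/
theorem AbsolutelyContinuousOnInterval.sq_sub_le {f : ℝ → ℝ} {a b : ℝ} (hab : a ≤ b)
    (hf : AbsolutelyContinuousOnInterval f a b) :
    ENNReal.ofReal ((f b - f a) ^ 2) ≤
      ENNReal.ofReal (b - a) * ∫⁻ x in Ioc a b, ENNReal.ofReal (deriv f x ^ 2) := by
  have key : ∀ y : ℝ, ENNReal.ofReal (y ^ 2) = ‖y‖ₑ ^ 2 := fun y => by
    rw [← sq_abs, ENNReal.ofReal_pow (abs_nonneg y), ← Real.norm_eq_abs, ofReal_norm]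
  rw [← hf.integral_deriv_eq_sub, intervalIntegral.integral_of_le hab, ← Real.volume_Ioc]
  simp only [key]
  refine le_trans ?_ (sq_setLIntegral_le_volume_mul (measurable_deriv f).enorm)
  gcongr
  exact enorm_integral_le_lintegral_enorm _

theorem LipschitzWith.sq_sub_le_lintegral_deriv {f : ℝ → ℝ} {K : NNReal} (hf : LipschitzWith K f)
    {a b : ℝ} (hab : a ≤ b) :
    ENNReal.ofReal ((f b - f a) ^ 2) ≤
      ENNReal.ofReal (b - a) * ∫⁻ x in Ioc a b, ENNReal.ofReal (deriv f x ^ 2) :=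
  (hf.lipschitzOnWith (s := uIcc a b)).absolutelyContinuousOnInterval.sq_sub_le hab

theorem LipschitzWith.sq_dist_le_lintegral_deriv {f : ℝ → ℝ} {K : NNReal} (hf : LipschitzWith K f)
    (a b : ℝ) :
    ENNReal.ofReal (dist (f a) (f b) ^ 2) ≤
      ENNReal.ofReal (dist a b) * ∫⁻ x in uIoc a b, ENNReal.ofReal (deriv f x ^ 2) := by
  rcases le_total a b with h | h
  · rw [uIoc_of_le h, dist_comm, dist_comm a, Real.dist_eq, Real.dist_eq, sq_abs,
      abs_of_nonneg (sub_nonneg.2 h)]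
    exact hf.sq_sub_le_lintegral_deriv h
  · rw [uIoc_of_ge h, Real.dist_eq, Real.dist_eq, sq_abs, abs_of_nonneg (sub_nonneg.2 h)]
    exact hf.sq_sub_le_lintegral_deriv h

open AbsolutelyContinuousOnInterval in
-- Cauchy–Schwarz on each interval and then over the disjoint intervals. The Lipschitz constant does
-- not enter the bound, so the bound survives pointwise limits.
theorem LipschitzWith.sq_sum_dist_le {f : ℝ → ℝ} {L : NNReal} (hf : LipschitzWith L f)
    {a b K : ℝ} (hK : 0 ≤ K)
    (hb : ∫⁻ x in uIcc a b, ENNReal.ofReal (deriv f x ^ 2) ≤ ENNReal.ofReal K)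
    {E : ℕ × (ℕ → ℝ × ℝ)} (hE : E ∈ disjWithin a b) :
    (∑ i ∈ Finset.range E.1, dist (f (E.2 i).1) (f (E.2 i).2)) ^ 2 ≤
      (∑ i ∈ Finset.range E.1, dist (E.2 i).1 (E.2 i).2) * K := by
  set I : ℕ → ENNReal := fun i =>
    ∫⁻ x in uIoc (E.2 i).1 (E.2 i).2, ENNReal.ofReal (deriv f x ^ 2) with hI
  have hsum : ∑ i ∈ Finset.range E.1, I i ≤ ENNReal.ofReal K := by
    rw [hI, ← lintegral_biUnion_finset hE.2 (fun _ _ => measurableSet_uIoc)]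
    refine (lintegral_mono_set ?_).trans hb
    refine iUnion₂_subset fun i hi => ?_
    exact uIoc_subset_uIcc.trans (uIcc_subset_uIcc (hE.1 i hi).1 (hE.1 i hi).2)
  have hfin : ∀ i ∈ Finset.range E.1, I i ≠ ⊤ := fun i hi =>
    ne_top_of_le_ne_top ENNReal.ofReal_ne_top
      ((Finset.single_le_sum_of_canonicallyOrdered hi).trans hsum)
  have h1 : ∀ i ∈ Finset.range E.1,
      dist (f (E.2 i).1) (f (E.2 i).2) ^ 2 ≤ dist (E.2 i).1 (E.2 i).2 * (I i).toReal := by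
    intro i hi
    have : ENNReal.ofReal (dist (f (E.2 i).1) (f (E.2 i).2) ^ 2) ≤
        ENNReal.ofReal (dist (E.2 i).1 (E.2 i).2) * I i :=
      hf.sq_dist_le_lintegral_deriv (E.2 i).1 (E.2 i).2
    rw [← ENNReal.ofReal_toReal (hfin i hi), ← ENNReal.ofReal_mul dist_nonneg] at this
    exact (ENNReal.ofReal_le_ofReal_iff (by positivity)).1 this
  refine (Finset.sum_sq_le_sum_mul_sum_of_sq_le_mul _ (fun _ _ => dist_nonneg)
    (fun _ _ => ENNReal.toReal_nonneg) h1).trans ?_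
  gcongr
  rw [← ENNReal.toReal_sum hfin]
  exact ENNReal.toReal_le_of_le_ofReal hK hsum

/-- A pointwise limit of Lipschitz functions with bounded energies is absolutely continuous. -/
theorem absolutelyContinuousOnInterval_of_tendsto {g : ℕ → ℝ → ℝ} {f : ℝ → ℝ} {a b K : ℝ}
    (hK : 0 ≤ K) (hg : ∀ n, ∃ L, LipschitzWith L (g n))
    (hb : ∀ n, ∫⁻ x in uIcc a b, ENNReal.ofReal (deriv (g n) x ^ 2) ≤ ENNReal.ofReal K)
    (hlim : ∀ x ∈ uIcc a b, Tendsto (fun n => g n x) atTop (𝓝 (f x))) :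
    AbsolutelyContinuousOnInterval f a b := by
  rw [absolutelyContinuousOnInterval_iff]
  intro ε hε
  -- The squared variation is at most length times K, hence below ε². The summand 1 allows K = 0.
  refine ⟨ε ^ 2 / (K + 1), by positivity, fun E hE hlen => ?_⟩
  have h1 : (∑ i ∈ Finset.range E.1, dist (f (E.2 i).1) (f (E.2 i).2)) ^ 2 ≤
      (∑ i ∈ Finset.range E.1, dist (E.2 i).1 (E.2 i).2) * K := by
    refine le_of_tendsto ((tendsto_finsetSum _ fun i hi =>
      (hlim _ (hE.1 i hi).1).dist (hlim _ (hE.1 i hi).2)).pow 2) (Eventually.of_forall fun n => ?_)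
    obtain ⟨L, hL⟩ := hg n
    exact hL.sq_sum_dist_le hK (hb n) hE
  have h0 : 0 ≤ ∑ i ∈ Finset.range E.1, dist (E.2 i).1 (E.2 i).2 :=
    Finset.sum_nonneg fun _ _ => dist_nonneg
  rw [lt_div_iff₀ (by positivity)] at hlen
  refine lt_of_pow_lt_pow_left₀ 2 hε.le ?_
  rcases h0.eq_or_lt with h | h
  · rw [← h, zero_mul] at h1
    exact h1.trans_lt (by positivity)
  · nlinarith

/-- Functions with bounded energies that converge in `L²` to a continuous function converge to it
pointwise. -/
theorem tendsto_of_tendsto_lintegral_sq {g : ℕ → ℝ → ℝ} {f : ℝ → ℝ} {a b K : ℝ}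
    (hK : 0 ≤ K) (hg : ∀ n, ∃ L, LipschitzWith L (g n))
    (hb : ∀ n, ∫⁻ x in Ioo a b, ENNReal.ofReal (deriv (g n) x ^ 2) ≤ ENNReal.ofReal K)
    (hf : ContinuousOn f (Ioo a b))
    (hlim : Tendsto (fun n => ∫⁻ x in Ioo a b, ENNReal.ofReal ((g n x - f x) ^ 2)) atTop (𝓝 0))
    {x : ℝ} (hx : x ∈ Ioo a b) : Tendsto (fun n => g n x) atTop (𝓝 (f x)) := by
  rw [Metric.tendsto_atTop]
  intro η hη
  obtain ⟨δ₁, hδ₁, h1⟩ := Metric.continuousOn_iff.1 hf x hx (η / 4) (by positivity)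
  -- On [x, x + δ] three things hold: f varies by less than η/4, the interval stays in (a, b), and
  -- the energy bound makes every g n vary by at most √(δK) ≤ η/4. A gap η at x would then persist
  -- as a gap η/4 on all of [x, x + δ], against the convergence in L².
  set δ := min (min (δ₁ / 2) ((b - x) / 2)) ((η / 4) ^ 2 / (K + 1)) with hδdef
  have hδ : 0 < δ := by
    refine lt_min (lt_min (by positivity) (by linarith [hx.2])) (by positivity)
  have hd1 : δ ≤ δ₁ / 2 := (min_le_left _ _).trans (min_le_left _ _)
  have hd2 : δ ≤ (b - x) / 2 := (min_le_left _ _).trans (min_le_right _ _)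
  have hd3 : δ * K ≤ (η / 4) ^ 2 := by
    have : δ * (K + 1) ≤ (η / 4) ^ 2 := by
      rw [← le_div_iff₀ (by positivity)]; exact min_le_right _ _
    nlinarith
  have hsub : Icc x (x + δ) ⊆ Ioo a b := fun y hy => ⟨by linarith [hx.1, hy.1], by
    linarith [hy.2, hx.2]⟩
  have hpos : (0 : ENNReal) < ENNReal.ofReal ((η / 4) ^ 2) * ENNReal.ofReal δ := by
    rw [← ENNReal.ofReal_mul (by positivity)]
    exact ENNReal.ofReal_pos.2 (by positivity)
  obtain ⟨N, hN⟩ := eventually_atTop.1 (hlim.eventually_lt_const hpos)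
  refine ⟨N, fun n hn => ?_⟩
  by_contra! hcon
  refine (hN n hn).not_ge ?_
  have hlow : ∀ y ∈ Icc x (x + δ),
      ENNReal.ofReal ((η / 4) ^ 2) ≤ ENNReal.ofReal ((g n y - f y) ^ 2) := by
    intro y hy
    apply ENNReal.ofReal_le_ofReal
    have h2 : dist (f y) (f x) < η / 4 := h1 y (hsub hy) (by
      rw [Real.dist_eq, abs_of_nonneg (by linarith [hy.1])]; linarith [hy.2])
    have h3 : dist (g n x) (g n y) ≤ η / 4 := by
      obtain ⟨L, hL⟩ := hg n
      have := hL.sq_sub_le_lintegral_deriv hy.1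
      have h4 : ENNReal.ofReal ((g n y - g n x) ^ 2) ≤ ENNReal.ofReal ((y - x) * K) := by
        rw [ENNReal.ofReal_mul (by linarith [hy.1])]
        refine this.trans ?_
        gcongr
        refine (lintegral_mono_set ?_).trans (hb n)
        exact fun z hz => hsub ⟨hz.1.le, hz.2.trans hy.2⟩
      have h5 := (ENNReal.ofReal_le_ofReal_iff (mul_nonneg (by linarith [hy.1]) hK)).1 h4
      rw [dist_comm, Real.dist_eq]
      refine abs_le_of_sq_le_sq (h5.trans ?_) (by positivity)
      refine le_trans ?_ hd3
      gcongr
      linarith [hy.2]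
    have h6 : η / 4 ≤ |g n y - f y| := by
      rw [← Real.dist_eq]
      have := dist_triangle4 (g n x) (g n y) (f y) (f x)
      linarith
    rw [← sq_abs (g n y - f y)]
    gcongr
  calc ENNReal.ofReal ((η / 4) ^ 2) * ENNReal.ofReal δ
      = ∫⁻ _ in Icc x (x + δ), ENNReal.ofReal ((η / 4) ^ 2) := by
        rw [setLIntegral_const, Real.volume_Icc]; congr 2; ring
    _ ≤ ∫⁻ y in Icc x (x + δ), ENNReal.ofReal ((g n y - f y) ^ 2) :=
        setLIntegral_mono' measurableSet_Icc hlow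
    _ ≤ _ := lintegral_mono_set hsub

namespace WeightedGraph

variable {V : Type u} {W : WeightedGraph V}

/-! ### Edges and vertices of the cable system -/

theorem adj_src_tgt (e : W.Edge) : W.graph.Adj (src e) (tgt e) := by
  have h := e.2
  rwa [edge_eq e, SimpleGraph.mem_edgeSet] at h

theorem weight_pos (e : W.Edge) : 0 < W.weight (src e) (tgt e) :=
  (W.weight_pos_iff _ _).2 (adj_src_tgt e)

theorem exists_adj (v : V) : ∃ w, W.graph.Adj v w := by
  have := W.infinite
  exact W.connected.preconnected.exists_adj_of_nontrivial v

theorem exists_isOver (v : V) : ∃ p : W.Cable, IsOver p v := by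
  obtain ⟨w, hw⟩ := W.exists_adj v
  obtain ⟨e, s, _, h, _⟩ := exists_edge_of_adj hw
  exact ⟨_, h⟩

variable (W) in
/-- The point of the cable system given by a vertex. -/
noncomputable def vtx (v : V) : W.Cable := (W.exists_isOver v).choose

theorem isOver_vtx (v : V) : IsOver (W.vtx v) v := (W.exists_isOver v).choose_spec

theorem edgePath_coe (e : W.Edge) (t : unitInterval) : edgePath e t = proj (e, t) := by
  rw [edgePath, projIcc_val]

theorem edgePath_of_mem (e : W.Edge) {t : ℝ} (ht : t ∈ Icc (0 : ℝ) 1) :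
    edgePath e t = proj (e, ⟨t, ht⟩) := edgePath_coe e ⟨t, ht⟩

theorem edgePath_zero (e : W.Edge) : edgePath e 0 = W.vtx (src e) :=
  IsOver.unique ⟨e, Or.inl ⟨edgePath_coe e 0, rfl⟩⟩ (isOver_vtx _)

theorem edgePath_one (e : W.Edge) : edgePath e 1 = W.vtx (tgt e) :=
  IsOver.unique ⟨e, Or.inr ⟨edgePath_coe e 1, rfl⟩⟩ (isOver_vtx _)

theorem exists_edgePath_eq (p : W.Cable) : ∃ (e : W.Edge), ∃ t ∈ Icc (0 : ℝ) 1,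
    edgePath e t = p := by
  obtain ⟨⟨e, t⟩, rfl⟩ := Quot.exists_rep p
  exact ⟨e, t, t.2, edgePath_coe e t⟩

theorem dist_edgePath_le (e : W.Edge) (s t : ℝ) : dist (edgePath e s) (edgePath e t) ≤ |s - t| :=
  (isAdmissible_cableDist.edge_le e _ _).trans (by
    have h := (LipschitzWith.projIcc (zero_le_one (α := ℝ))).dist_le_mul s t
    rwa [NNReal.coe_one, one_mul, Subtype.dist_eq] at h)

theorem lipschitzWith_edgePath (e : W.Edge) : LipschitzWith 1 (edgePath e) :=
  LipschitzWith.of_dist_le_mul fun s t => by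
    rw [NNReal.coe_one, one_mul]; exact dist_edgePath_le e s t

/-- Edges are isometrically embedded: the tent at the source has unit slope along the edge, and its
increments bound the maximal metric from below. -/
theorem dist_edgePath (e : W.Edge) {s t : ℝ} (hs : s ∈ Icc (0 : ℝ) 1) (ht : t ∈ Icc (0 : ℝ) 1) :
    dist (edgePath e s) (edgePath e t) = |s - t| := by
  refine le_antisymm (dist_edgePath_le e s t) ?_
  have h := abs_sub_le_cableDist (vertexBump_lip (W := W) (src e)) (edgePath e s) (edgePath e t)
  rw [edgePath_of_mem e hs, edgePath_of_mem e ht] at h ⊢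
  simp only [vertexBump, proj, if_true] at h
  rw [abs_sub_comm]
  rwa [sub_sub_sub_cancel_left] at h

theorem isClosedEmbedding_proj (e : W.Edge) :
    Topology.IsClosedEmbedding fun t : unitInterval => proj (e, t) := by
  have : Isometry fun t : unitInterval => proj (e, t) := Isometry.of_dist_eq fun s t => by
    rw [← edgePath_coe, ← edgePath_coe, dist_edgePath e s.2 t.2]; rfl
  exact this.isClosedEmbedding

/-- The bump at an interior point has height `min s (1 - s)` and vanishes off the edge, so every
point off the edge is at least that far away. -/
theorem exists_edgePath_of_dist_lt (e : W.Edge) {s : ℝ} (hs : s ∈ Ioo (0 : ℝ) 1) {y : W.Cable}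
    (h : dist (edgePath e s) y < min s (1 - s)) :
    ∃ t ∈ Icc (0 : ℝ) 1, edgePath e t = y := by
  have hs' : s ∈ Icc (0 : ℝ) 1 := Ioo_subset_Icc_self hs
  have h1 := abs_sub_le_cableDist (edgeBump_lip (W := W) e ⟨s, hs'⟩) (edgePath e s) y
  obtain ⟨⟨e', t⟩, rfl⟩ := Quot.exists_rep y
  by_cases he : e' = e
  · exact ⟨t, t.2, he ▸ edgePath_coe e t⟩
  · exfalso
    have hpos : 0 < min s (1 - s) := lt_min hs.1 (by linarith [hs.2])
    rw [edgePath_of_mem e hs'] at h1 h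
    simp only [edgeBump, proj, if_true, sub_self, abs_zero, sub_zero, he, if_false,
      max_eq_right hpos.le, abs_of_pos hpos] at h1
    exact h1.not_gt h

theorem isOpen_image_edgePath (e : W.Edge) {a b : ℝ} (ha : 0 ≤ a) (hb : b ≤ 1) :
    IsOpen (edgePath e '' Ioo a b) := by
  rw [Metric.isOpen_iff]
  rintro _ ⟨s, hs, rfl⟩
  have hs1 : s ∈ Ioo (0 : ℝ) 1 := ⟨ha.trans_lt hs.1, hs.2.trans_le hb⟩
  refine ⟨min (min s (1 - s)) (min (s - a) (b - s)), lt_min (lt_min hs1.1 (by linarith [hs1.2]))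
    (lt_min (by linarith [hs.1]) (by linarith [hs.2])), fun y hy => ?_⟩
  rw [Metric.mem_ball, dist_comm] at hy
  obtain ⟨t, ht, rfl⟩ := exists_edgePath_of_dist_lt e hs1 (hy.trans_le (min_le_left _ _))
  rw [dist_edgePath e (Ioo_subset_Icc_self hs1) ht] at hy
  have h1 := abs_lt.1 (hy.trans_le ((min_le_right _ _).trans (min_le_left _ _)))
  have h2 := abs_lt.1 (hy.trans_le ((min_le_right _ _).trans (min_le_right _ _)))
  exact ⟨t, ⟨by linarith, by linarith⟩, rfl⟩

theorem dist_edgePath_vtx_src (e : W.Edge) {t : ℝ} (ht : t ∈ Icc (0 : ℝ) 1) :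
    dist (edgePath e t) (W.vtx (src e)) = t := by
  rw [← edgePath_zero, dist_edgePath e ht (by simp), sub_zero, abs_of_nonneg ht.1]

theorem dist_edgePath_vtx_tgt (e : W.Edge) {t : ℝ} (ht : t ∈ Icc (0 : ℝ) 1) :
    dist (edgePath e t) (W.vtx (tgt e)) = 1 - t := by
  rw [← edgePath_one, dist_edgePath e ht (by simp), abs_sub_comm,
      abs_of_nonneg (by linarith [ht.2])]

theorem exists_dist_vtx_src_le (p : W.Cable) :
    ∃ e : W.Edge, ∃ t ∈ Icc (0 : ℝ) 1, edgePath e t = p ∧ dist p (W.vtx (src e)) ≤ 1 := by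
  obtain ⟨e, t, ht, rfl⟩ := exists_edgePath_eq p
  exact ⟨e, t, ht, rfl, (dist_edgePath_vtx_src e ht).le.trans ht.2⟩

/-! ### Comparison of the metrics -/

theorem dist_vtx_le (v w : V) : dist (W.vtx v) (W.vtx w) ≤ W.graph.dist v w := by
  obtain ⟨c, hc⟩ := W.connected.exists_walk_length_eq_dist v w
  rw [← hc]
  exact isAdmissible_cableDist.le_of_walk c (isOver_vtx v) (isOver_vtx w)

/-- The distance from the point `γ_{e₀}(s₀)` to the vertex `b`. -/
noncomputable def vertexDistFrom (e₀ : W.Edge) (s₀ : ℝ) (b : V) : ℝ :=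
  min (s₀ + W.graph.dist (src e₀) b) (1 - s₀ + W.graph.dist (tgt e₀) b)

theorem graphDist_le_add_one {a b : V} (h : W.graph.Adj a b) (v : V) :
    (W.graph.dist v b : ℝ) ≤ W.graph.dist v a + 1 := by
  have := W.connected.dist_triangle (u := v) (v := a) (w := b)
  rw [SimpleGraph.dist_eq_one_iff_adj.2 h] at this
  exact_mod_cast this

theorem vertexDistFrom_le_add_one (e₀ : W.Edge) (s₀ : ℝ) {a b : V} (h : W.graph.Adj a b) :
    vertexDistFrom e₀ s₀ b ≤ vertexDistFrom e₀ s₀ a + 1 := by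
  have h1 := graphDist_le_add_one h (src e₀)
  have h2 := graphDist_le_add_one h (tgt e₀)
  rw [vertexDistFrom, vertexDistFrom, ← min_add_add_right]
  exact min_le_min (by linarith) (by linarith)

theorem vertexDistFrom_src_le (e₀ : W.Edge) (s₀ : ℝ) : vertexDistFrom e₀ s₀ (src e₀) ≤ s₀ :=
  (min_le_left _ _).trans (by simp)

theorem vertexDistFrom_tgt_le (e₀ : W.Edge) (s₀ : ℝ) : vertexDistFrom e₀ s₀ (tgt e₀) ≤ 1 - s₀ :=
  (min_le_right _ _).trans (by simp)

/-- The distance from the point `γ_{e₀}(s₀)` to `γ_e(t)` through the endpoints of `e`. -/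
noncomputable def outerDistFrom (e₀ : W.Edge) (s₀ : ℝ) (e : W.Edge) (t : ℝ) : ℝ :=
  min (vertexDistFrom e₀ s₀ (src e) + t) (vertexDistFrom e₀ s₀ (tgt e) + (1 - t))

theorem outerDistFrom_zero (e₀ : W.Edge) (s₀ : ℝ) (e : W.Edge) :
    outerDistFrom e₀ s₀ e 0 = vertexDistFrom e₀ s₀ (src e) := by
  have := vertexDistFrom_le_add_one e₀ s₀ (adj_src_tgt e).symm
  rw [outerDistFrom, min_eq_left (by linarith), add_zero]

theorem outerDistFrom_one (e₀ : W.Edge) (s₀ : ℝ) (e : W.Edge) :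
    outerDistFrom e₀ s₀ e 1 = vertexDistFrom e₀ s₀ (tgt e) := by
  have := vertexDistFrom_le_add_one e₀ s₀ (adj_src_tgt e)
  rw [outerDistFrom, min_eq_right (by linarith), sub_self, add_zero]

theorem abs_outerDistFrom_sub_le (e₀ : W.Edge) (s₀ : ℝ) (e : W.Edge) (s t : ℝ) :
    |outerDistFrom e₀ s₀ e s - outerDistFrom e₀ s₀ e t| ≤ |s - t| := by
  refine (abs_min_sub_min_le_max _ _ _ _).trans (max_le ?_ ?_)
  · rw [add_sub_add_left_eq_sub]
  · rw [add_sub_add_left_eq_sub, sub_sub_sub_cancel_left, abs_sub_comm]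

open Classical in
/-- The function `t ↦ d(γ_{e₀}(s₀), γ_e(t))` on an edge. -/
noncomputable def edgeDistFrom (e₀ : W.Edge) (s₀ : ℝ) (e : W.Edge) (t : ℝ) : ℝ :=
  if e = e₀ then min |t - s₀| (outerDistFrom e₀ s₀ e t) else outerDistFrom e₀ s₀ e t

/-- The value at an endpoint depends only on the vertex. This and `edgeDistFrom_one` let the formula
descend to the quotient. -/
theorem edgeDistFrom_zero (e₀ : W.Edge) {s₀ : ℝ} (hs₀ : 0 ≤ s₀) (e : W.Edge) :
    edgeDistFrom e₀ s₀ e 0 = vertexDistFrom e₀ s₀ (src e) := by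
  classical
  rw [edgeDistFrom, outerDistFrom_zero, ite_eq_right_iff]
  rintro rfl
  rw [zero_sub, abs_neg, abs_of_nonneg hs₀]
  exact min_eq_right (vertexDistFrom_src_le e s₀)

theorem edgeDistFrom_one (e₀ : W.Edge) {s₀ : ℝ} (hs₀ : s₀ ≤ 1) (e : W.Edge) :
    edgeDistFrom e₀ s₀ e 1 = vertexDistFrom e₀ s₀ (tgt e) := by
  classical
  rw [edgeDistFrom, outerDistFrom_one, ite_eq_right_iff]
  rintro rfl
  rw [abs_of_nonneg (by linarith)]
  exact min_eq_right (vertexDistFrom_tgt_le e s₀)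

theorem abs_edgeDistFrom_sub_le (e₀ : W.Edge) (s₀ : ℝ) (e : W.Edge) (s t : ℝ) :
    |edgeDistFrom e₀ s₀ e s - edgeDistFrom e₀ s₀ e t| ≤ |s - t| := by
  rw [edgeDistFrom, edgeDistFrom]
  split_ifs
  · refine (abs_min_sub_min_le_max _ _ _ _).trans (max_le ?_ (abs_outerDistFrom_sub_le _ _ _ _ _))
    refine (abs_abs_sub_abs_le_abs_sub _ _).trans ?_
    rw [sub_sub_sub_cancel_right]
  · exact abs_outerDistFrom_sub_le _ _ _ _ _

/-- The explicit formula for the distance from a point, as a function on the cable system. -/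
noncomputable def distFrom (e₀ : W.Edge) (s₀ : unitInterval) : W.Cable → ℝ :=
  Quot.lift (fun p => edgeDistFrom e₀ s₀ p.1 p.2) (by
    have h0 := s₀.2.1
    have h1 := s₀.2.2
    rintro _ _ (⟨e, e', h⟩ | ⟨e, e', h⟩ | ⟨e, e', h⟩) <;>
      simp only [Set.Icc.coe_zero, Set.Icc.coe_one, edgeDistFrom_zero e₀ h0,
        edgeDistFrom_one e₀ h1, h])

/-- The explicit formula changes by at most |s - t| along each edge, so its increments form an
admissible pseudometric, which the maximal metric dominates. It vanishes at the base point. -/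
theorem edgeDistFrom_le_dist (e₀ : W.Edge) {s₀ : ℝ} (hs₀ : s₀ ∈ Icc (0 : ℝ) 1) (e : W.Edge)
    {t : ℝ} (ht : t ∈ Icc (0 : ℝ) 1) :
    edgeDistFrom e₀ s₀ e t ≤ dist (edgePath e₀ s₀) (edgePath e t) := by
  have h := abs_sub_le_cableDist (f := distFrom e₀ ⟨s₀, hs₀⟩)
    (fun e s t => abs_edgeDistFrom_sub_le e₀ s₀ e s t) (edgePath e t) (edgePath e₀ s₀)
  have h0 : distFrom e₀ ⟨s₀, hs₀⟩ (edgePath e₀ s₀) ≤ 0 := by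
    rw [edgePath_of_mem e₀ hs₀]
    change edgeDistFrom e₀ s₀ e₀ s₀ ≤ 0
    rw [edgeDistFrom, if_pos rfl, sub_self, abs_zero]
    exact min_le_left _ _
  have h1 : distFrom e₀ ⟨s₀, hs₀⟩ (edgePath e t) = edgeDistFrom e₀ s₀ e t := by
    rw [edgePath_of_mem e ht]; rfl
  rw [dist_comm]
  change _ ≤ cableDist _ _
  linarith [le_abs_self (distFrom e₀ ⟨s₀, hs₀⟩ (edgePath e t) -
    distFrom e₀ ⟨s₀, hs₀⟩ (edgePath e₀ s₀))]

theorem exists_edge_eq {a b : V} (h : W.graph.Adj a b) :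
    ∃ e : W.Edge, (src e = a ∧ tgt e = b) ∨ (src e = b ∧ tgt e = a) := by
  let e : W.Edge := ⟨s(a, b), h⟩
  have he : s(a, b) = s(src e, tgt e) := edge_eq e
  refine ⟨e, ?_⟩
  rcases Sym2.eq_iff.1 he with ⟨h1, h2⟩ | ⟨h1, h2⟩
  · exact Or.inl ⟨h1.symm, h2.symm⟩
  · exact Or.inr ⟨h2.symm, h1.symm⟩

theorem exists_edge_edgePath_eq_vtx (v : V) :
    ∃ e : W.Edge, (src e = v ∧ edgePath e 0 = W.vtx v) ∨ (tgt e = v ∧ edgePath e 1 = W.vtx v) := by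
  obtain ⟨w, hw⟩ := W.exists_adj v
  obtain ⟨e, ⟨h, _⟩ | ⟨_, h⟩⟩ := exists_edge_eq hw
  · exact ⟨e, Or.inl ⟨h, h ▸ edgePath_zero e⟩⟩
  · exact ⟨e, Or.inr ⟨h, h ▸ edgePath_one e⟩⟩

/-- View v as an endpoint of an edge. Starting from there, the detour through the other endpoint
cannot beat the graph distance. -/
theorem graphDist_le_dist_vtx (v w : V) : (W.graph.dist v w : ℝ) ≤ dist (W.vtx v) (W.vtx w) := by
  have key : ∀ (e₀ : W.Edge) (s₀ : ℝ), s₀ ∈ Icc (0 : ℝ) 1 →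
      vertexDistFrom e₀ s₀ w ≤ dist (edgePath e₀ s₀) (W.vtx w) := by
    intro e₀ s₀ hs₀
    obtain ⟨e, ⟨rfl, h⟩ | ⟨rfl, h⟩⟩ := exists_edge_edgePath_eq_vtx (W := W) w
    · rw [← edgeDistFrom_zero e₀ hs₀.1, ← h]
      exact edgeDistFrom_le_dist e₀ hs₀ e (by simp)
    · rw [← edgeDistFrom_one e₀ hs₀.2, ← h]
      exact edgeDistFrom_le_dist e₀ hs₀ e (by simp)
  obtain ⟨e, ⟨rfl, h⟩ | ⟨rfl, h⟩⟩ := exists_edge_edgePath_eq_vtx (W := W) v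
  · rw [← h]
    refine le_trans (le_min ?_ ?_) (key e 0 (by simp))
    · simp
    · have := graphDist_le_add_one (adj_src_tgt e) w
      have := graphDist_le_add_one (adj_src_tgt e).symm w
      rw [SimpleGraph.dist_comm, SimpleGraph.dist_comm (u := tgt e)]
      linarith
  · rw [← h]
    refine le_trans (le_min ?_ ?_) (key e 1 (by simp))
    · have := graphDist_le_add_one (adj_src_tgt e) w
      rw [SimpleGraph.dist_comm, SimpleGraph.dist_comm (u := src e)]
      linarith
    · simp

/-! ### Integrals over the cable system -/

/-- No measurability of g is required, because on [0,1] each edge is a closed embedding. The formula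
thus applies directly to the gradient of an arbitrary function. -/
theorem lintegral_cableMeasure (g : W.Cable → ENNReal) :
    ∫⁻ x, g x ∂W.cableMeasure = ∑' e : W.Edge,
      ENNReal.ofReal (W.weight (src e) (tgt e)) * ∫⁻ t in Icc (0 : ℝ) 1, g (edgePath e t) := by
  rw [cableMeasure, lintegral_sum_measure]
  congr 1 with e
  rw [lintegral_smul_measure, smul_eq_mul]
  congr 1
  have h : (volume.restrict (Icc (0 : ℝ) 1)).map (edgePath e) =
      (Measure.comap Subtype.val volume).map fun t : unitInterval => proj (e, t) := by
    rw [← map_comap_subtype_coe measurableSet_Icc volume,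
      Measure.map_map (lipschitzWith_edgePath e).continuous.measurable measurable_subtype_coe]
    congr 1
    ext t
    exact edgePath_coe e t
  rw [h, (isClosedEmbedding_proj e).measurableEmbedding.lintegral_map,
    ← lintegral_subtype_comap measurableSet_Icc]
  simp only [edgePath_coe]

theorem sum_le_setLIntegral_cableMeasure {S : Set W.Cable} (hS : MeasurableSet S)
    (g : W.Cable → ENNReal) (T : Finset W.Edge) (J : W.Edge → Set ℝ)
    (hJ : ∀ e ∈ T, MeasurableSet (J e)) (hJ1 : ∀ e ∈ T, J e ⊆ Icc 0 1)
    (hJS : ∀ e ∈ T, ∀ t ∈ J e, edgePath e t ∈ S) :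
    ∑ e ∈ T, ENNReal.ofReal (W.weight (src e) (tgt e)) * ∫⁻ t in J e, g (edgePath e t) ≤
      ∫⁻ x in S, g x ∂W.cableMeasure := by
  rw [← lintegral_indicator hS, lintegral_cableMeasure]
  refine le_trans (Finset.sum_le_sum fun e he => ?_) (ENNReal.sum_le_tsum T)
  gcongr 1
  refine (setLIntegral_mono' (hJ e he) fun t ht => ?_).trans (lintegral_mono_set (hJ1 e he))
  rw [indicator_of_mem (hJS e he t ht)]

theorem gradNorm_edgePath (f : W.Cable → ℝ) (e : W.Edge) {t : ℝ} (ht : t ∈ Ioo (0 : ℝ) 1) :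
    gradNorm f (edgePath e t) = |deriv (fun t => f (edgePath e t)) t| := by
  rw [edgePath_of_mem e (Ioo_subset_Icc_self ht)]
  simp only [gradNorm, proj]
  rw [if_neg]
  rw [Subtype.ext_iff, Subtype.ext_iff]
  simp only [Icc.coe_zero, Icc.coe_one, not_or]
  exact ⟨ht.1.ne', ht.2.ne⟩

theorem sum_le_energyOn {S : Set W.Cable} (hS : MeasurableSet S) (u : W.Cable → ℝ)
    (T : Finset W.Edge) {J : Set ℝ} (hJ : MeasurableSet J) (hJ1 : J ⊆ Ioo 0 1)
    (hJS : ∀ e ∈ T, ∀ t ∈ J, edgePath e t ∈ S) :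
    ∑ e ∈ T, ENNReal.ofReal (W.weight (src e) (tgt e)) *
        ∫⁻ t in J, ENNReal.ofReal (deriv (fun t => u (edgePath e t)) t ^ 2) ≤ energyOn S u := by
  refine le_trans (Finset.sum_le_sum fun e _ => ?_) (sum_le_setLIntegral_cableMeasure hS _ T
    (fun _ => J) (fun _ _ => hJ) (fun _ _ => hJ1.trans Ioo_subset_Icc_self) hJS)
  gcongr 1
  refine setLIntegral_mono' hJ fun t ht => ?_
  rw [gradNorm_edgePath u e (hJ1 ht), sq_abs]

theorem edge_le_energyOn {S : Set W.Cable} (hS : MeasurableSet S) (u : W.Cable → ℝ)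
    (e : W.Edge) {J : Set ℝ} (hJ : MeasurableSet J) (hJ1 : J ⊆ Ioo 0 1)
    (hJS : ∀ t ∈ J, edgePath e t ∈ S) :
    ENNReal.ofReal (W.weight (src e) (tgt e)) *
        ∫⁻ t in J, ENNReal.ofReal (deriv (fun t => u (edgePath e t)) t ^ 2) ≤ energyOn S u := by
  simpa using sum_le_energyOn hS u {e} hJ hJ1 (by simpa using hJS)

/-! ### Absolute continuity along edges -/

theorem IsCore.exists_lipschitzWith_edgePath {φ : W.Cable → ℝ} (hφ : IsCore φ) (e : W.Edge) :
    ∃ L, LipschitzWith L fun t => φ (edgePath e t) := by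
  obtain ⟨K, hK⟩ := hφ.2
  exact ⟨_, hK.comp (lipschitzWith_edgePath e)⟩

/-- Split φ n = (φ n - φ 0) + φ 0. The energy of the first part is at most 1 overall, hence at most
the inverse weight on this edge; the second part is Lipschitz. The bound then follows from p² ≤ 2(p
- q)² + 2q². -/
theorem exists_energy_bound {φ : ℕ → W.Cable → ℝ} (hφ : ∀ n, IsCore (φ n))
    (hb : ∀ n, energyOn univ (φ n - φ 0) ≤ 1) (e : W.Edge) :
    ∃ K : ℝ, 0 ≤ K ∧ ∀ n, ∫⁻ t in Ioo (0 : ℝ) 1,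
      ENNReal.ofReal (deriv (fun t => φ n (edgePath e t)) t ^ 2) ≤ ENNReal.ofReal K := by
  obtain ⟨L, hL⟩ := (hφ 0).exists_lipschitzWith_edgePath e
  set w := ENNReal.ofReal (W.weight (src e) (tgt e)) with hw
  have hw0 : w ≠ 0 := (ENNReal.ofReal_pos.2 (weight_pos e)).ne'
  have hwt : w ≠ ⊤ := ENNReal.ofReal_ne_top
  set M : ENNReal := 2 * w⁻¹ + ENNReal.ofReal (2 * L ^ 2) with hM
  have hMt : M ≠ ⊤ := by
    refine ENNReal.add_ne_top.2 ⟨ENNReal.mul_ne_top (by simp) ?_, ENNReal.ofReal_ne_top⟩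
    exact ENNReal.inv_ne_top.2 hw0
  refine ⟨M.toReal, ENNReal.toReal_nonneg, fun n => ?_⟩
  rw [ENNReal.ofReal_toReal hMt]
  obtain ⟨L', hL'⟩ := (hφ n).exists_lipschitzWith_edgePath e
  set f := fun t => φ n (edgePath e t) with hf
  set f₀ := fun t => φ 0 (edgePath e t) with hf₀
  have h1 : ∫⁻ t in Ioo (0 : ℝ) 1, ENNReal.ofReal (deriv (f - f₀) t ^ 2) ≤ w⁻¹ := by
    have h := (edge_le_energyOn MeasurableSet.univ (φ n - φ 0) e (J := Ioo 0 1) measurableSet_Ioo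
      subset_rfl (fun _ _ => mem_univ _)).trans (hb n)
    rw [ENNReal.le_inv_iff_mul_le, mul_comm]
    exact h
  have h2 : ∀ᵐ t ∂volume.restrict (Ioo (0 : ℝ) 1), ENNReal.ofReal (deriv f t ^ 2) ≤
      2 * ENNReal.ofReal (deriv (f - f₀) t ^ 2) + ENNReal.ofReal (2 * L ^ 2) := by
    refine ae_restrict_of_ae ?_
    filter_upwards [hL.ae_differentiableAt, hL'.ae_differentiableAt] with t ht ht'
    rw [deriv_sub ht' ht, ← ENNReal.ofReal_ofNat 2, ← ENNReal.ofReal_mul (by norm_num),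
      ← ENNReal.ofReal_add (by positivity) (by positivity)]
    apply ENNReal.ofReal_le_ofReal
    have h3 : ‖deriv f₀ t‖ ≤ L := norm_deriv_le_of_lipschitz hL
    have h4 : deriv f₀ t ^ 2 ≤ L ^ 2 := by
      rw [← sq_abs]; exact pow_le_pow_left₀ (abs_nonneg _) h3 2
    nlinarith [sq_nonneg (deriv f t - 2 * deriv f₀ t)]
  refine (lintegral_mono_ae h2).trans ?_
  rw [lintegral_add_right _ measurable_const, lintegral_const_mul' _ _ (by simp)]
  simp only [lintegral_const, Measure.restrict_apply, MeasurableSet.univ, univ_inter,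
    Real.volume_Ioo, sub_zero, ENNReal.ofReal_one, mul_one]
  rw [hM]
  gcongr

/-- On the open segment Ω, whose closure is compact in D, u agrees almost everywhere with an `L²`
limit of core functions. Their energies on the edge are bounded, so by continuity of u they converge
to it at every point of Ω, and absolute continuity passes to the limit. -/
theorem IsInReflectedDomain.absolutelyContinuousOnInterval {D : Set W.Cable} {u : W.Cable → ℝ}
    (hu : IsInReflectedDomain D u) (e : W.Edge) {a b : ℝ} (ha : 0 ≤ a) (hb : b ≤ 1)
    (hD : ∀ t ∈ Icc a b, edgePath e t ∈ D) {s t : ℝ} (hs : a < s) (hst : s ≤ t) (ht : t < b) :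
    AbsolutelyContinuousOnInterval (fun t => u (edgePath e t)) s t := by
  set Ω := edgePath e '' Ioo a b with hΩ
  have hcomp : IsCompact (edgePath e '' Icc a b) :=
    isCompact_Icc.image (lipschitzWith_edgePath e).continuous
  have hcl : closure Ω ⊆ edgePath e '' Icc a b :=
    closure_minimal (image_mono Ioo_subset_Icc_self) hcomp.isClosed
  have hΩo : IsOpen Ω := isOpen_image_edgePath e ha hb
  obtain ⟨-, v, ⟨-, φ, hφ, hcauchy, hlim⟩, huv⟩ := hu.2.1 Ω hΩo
    (hcomp.of_isClosed_subset isClosed_closure hcl) (hcl.trans (image_subset_iff.2 hD))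
  -- Only the tail from N on is used: its members are within energy 1 of its first member.
  obtain ⟨N, hN⟩ := hcauchy 1 one_pos
  have hbd : ∀ n, energyOn univ (φ (n + N) - φ (0 + N)) ≤ 1 := fun n =>
    le_self_add.trans (hN (n + N) (by omega) (0 + N) (by omega))
  obtain ⟨K, hK0, hK⟩ := exists_energy_bound (φ := fun n => φ (n + N)) (fun n => hφ _) hbd e
  set w := ENNReal.ofReal (W.weight (src e) (tgt e)) with hw
  have hw0 : w ≠ 0 := (ENNReal.ofReal_pos.2 (weight_pos e)).ne'
  have hwt : w ≠ ⊤ := ENNReal.ofReal_ne_top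
  have hsub : Ioo a b ⊆ Ioo 0 1 := Ioo_subset_Ioo ha hb
  have hlip : ∀ n, ∃ L, LipschitzWith L fun t => φ (n + N) (edgePath e t) :=
    fun n => (hφ _).exists_lipschitzWith_edgePath e
  have hmass : ∀ n, ∫⁻ x in Ioo a b, ENNReal.ofReal
      ((φ (n + N) (edgePath e x) - u (edgePath e x)) ^ 2) ≤
        w⁻¹ * massOn univ (φ (n + N) - v) := by
    intro n
    have h1 := sum_le_setLIntegral_cableMeasure hΩo.measurableSet
      (fun x => ENNReal.ofReal ((φ (n + N) x - u x) ^ 2)) {e} (fun _ => Ioo a b)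
      (fun _ _ => measurableSet_Ioo) (fun _ _ => hsub.trans Ioo_subset_Icc_self)
      (fun e' he t ht => by rw [Finset.mem_singleton.1 he]; exact mem_image_of_mem _ ht)
    rw [Finset.sum_singleton] at h1
    have h2 : ∫⁻ x in Ω, ENNReal.ofReal ((φ (n + N) x - u x) ^ 2) ∂W.cableMeasure =
        ∫⁻ x in Ω, ENNReal.ofReal ((φ (n + N) x - v x) ^ 2) ∂W.cableMeasure :=
      lintegral_congr_ae (huv.mono fun x hx => by simp only [hx])
    rw [mul_comm, ← div_eq_mul_inv, ENNReal.le_div_iff_mul_le (Or.inl hw0) (Or.inl hwt), mul_comm]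
    refine h1.trans (h2.le.trans ?_)
    rw [massOn]
    exact lintegral_mono_set (subset_univ _)
  have hzero : Tendsto (fun n => ∫⁻ x in Ioo a b, ENNReal.ofReal
      ((φ (n + N) (edgePath e x) - u (edgePath e x)) ^ 2)) atTop (𝓝 0) := by
    have h := ENNReal.Tendsto.const_mul ((tendsto_add_atTop_iff_nat N).2 hlim)
      (Or.inr (ENNReal.inv_ne_top.2 hw0))
    rw [mul_zero] at h
    exact tendsto_of_tendsto_of_tendsto_of_le_of_le tendsto_const_nhds h (fun _ => zero_le) hmass
  have hcont : ContinuousOn (fun t => u (edgePath e t)) (Ioo a b) :=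
    hu.1.comp (lipschitzWith_edgePath e).continuous.continuousOn
      fun t ht => hD t (Ioo_subset_Icc_self ht)
  have hst' : uIcc s t ⊆ Ioo a b := by
    rw [uIcc_of_le hst]
    exact fun x hx => ⟨hs.trans_le hx.1, hx.2.trans_lt ht⟩
  refine absolutelyContinuousOnInterval_of_tendsto hK0 hlip
    (fun n => (lintegral_mono_set (hst'.trans hsub)).trans (hK n)) fun x hx => ?_
  exact tendsto_of_tendsto_lintegral_sq hK0 hlip
    (fun n => (lintegral_mono_set hsub).trans (hK n)) hcont hzero (hst' hx)

/-- The oscillation of `u` along a segment of an edge is controlled by the energy. -/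
theorem IsInReflectedDomain.sq_sub_le_lintegral {D : Set W.Cable} {u : W.Cable → ℝ}
    (hu : IsInReflectedDomain D u) (e : W.Edge) {a b : ℝ} (ha : 0 ≤ a) (hab : a ≤ b) (hb : b ≤ 1)
    (hD : ∀ t ∈ Icc a b, edgePath e t ∈ D) :
    ENNReal.ofReal ((u (edgePath e b) - u (edgePath e a)) ^ 2) ≤ ENNReal.ofReal (b - a) *
      ∫⁻ t in Ioo a b, ENNReal.ofReal (deriv (fun t => u (edgePath e t)) t ^ 2) := by
  rcases hab.eq_or_lt with rfl | hab
  · simp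
  set h : ℝ → ℝ := fun t => u (edgePath e t) with hh
  have hcont : ContinuousOn h (Icc a b) :=
    hu.1.comp (lipschitzWith_edgePath e).continuous.continuousOn hD
  have hle : ∀ s t, a < s → s ≤ t → t < b → ENNReal.ofReal ((h t - h s) ^ 2) ≤
      ENNReal.ofReal (b - a) * ∫⁻ t in Ioo a b, ENNReal.ofReal (deriv h t ^ 2) := by
    intro s t hs hst ht
    refine ((hu.absolutelyContinuousOnInterval e ha hb hD hs hst ht).sq_sub_le hst).trans ?_
    gcongr
    exact fun x hx => ⟨hs.trans hx.1, hx.2.trans_lt ht⟩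
  -- Absolute continuity is available only strictly inside (a, b). The endpoints are reached by
  -- continuity, from [a + δₙ, b - δₙ] with δₙ tending to 0.
  have hδ : Tendsto (fun n : ℕ => (b - a) / 2 / ((n : ℝ) + 1)) atTop (𝓝 0) :=
    ((tendsto_const_div_atTop_nhds_zero_nat ((b - a) / 2)).comp (tendsto_add_atTop_nat 1)).congr
      fun n => by simp
  have hpos : ∀ n : ℕ, 0 < (b - a) / 2 / ((n : ℝ) + 1) := fun n => by
    have : 0 < b - a := by linarith
    positivity
  have hhalf : ∀ n : ℕ, (b - a) / 2 / ((n : ℝ) + 1) ≤ (b - a) / 2 := fun n =>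
    div_le_self (by linarith) (by linarith [n.cast_nonneg (α := ℝ)])
  have hta : Tendsto (fun n : ℕ => h (a + (b - a) / 2 / ((n : ℝ) + 1))) atTop (𝓝 (h a)) := by
    refine (hcont a (left_mem_Icc.2 hab.le)).tendsto.comp (tendsto_nhdsWithin_iff.2 ⟨?_, ?_⟩)
    · simpa using tendsto_const_nhds.add hδ
    · exact Eventually.of_forall fun n => ⟨by linarith [hpos n], by linarith [hhalf n]⟩
  have htb : Tendsto (fun n : ℕ => h (b - (b - a) / 2 / ((n : ℝ) + 1))) atTop (𝓝 (h b)) := by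
    refine (hcont b (right_mem_Icc.2 hab.le)).tendsto.comp (tendsto_nhdsWithin_iff.2 ⟨?_, ?_⟩)
    · simpa using tendsto_const_nhds.sub hδ
    · exact Eventually.of_forall fun n => ⟨by linarith [hhalf n], by linarith [hpos n]⟩
  refine le_of_tendsto (ENNReal.continuous_ofReal.continuousAt.tendsto.comp ((htb.sub hta).pow 2))
    (Eventually.of_forall fun n => hle _ _ ?_ ?_ ?_)
  · linarith [hpos n]
  · linarith [hhalf n]
  · linarith [hpos n]

theorem IsInReflectedDomain.sq_sub_mul_weight_le {D S : Set W.Cable} {u : W.Cable → ℝ}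
    (hu : IsInReflectedDomain D u) (hS : MeasurableSet S) (hfin : energyOn S u ≠ ⊤)
    (e : W.Edge) {a b : ℝ} (ha : 0 ≤ a) (hab : a ≤ b) (hb : b ≤ 1)
    (hD : ∀ t ∈ Icc a b, edgePath e t ∈ D) (hS' : ∀ t ∈ Icc a b, edgePath e t ∈ S) :
    (u (edgePath e b) - u (edgePath e a)) ^ 2 * W.weight (src e) (tgt e) ≤
      (b - a) * (energyOn S u).toReal := by
  have h1 := hu.sq_sub_le_lintegral e ha hab hb hD
  have h2 := edge_le_energyOn hS u e (J := Ioo a b) measurableSet_Ioo (Ioo_subset_Ioo ha hb)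
    fun t ht => hS' t (Ioo_subset_Icc_self ht)
  have hab' : 0 ≤ b - a := sub_nonneg.2 hab
  refine (ENNReal.ofReal_le_ofReal_iff (by positivity)).1 ?_
  rw [ENNReal.ofReal_mul (by positivity), ENNReal.ofReal_mul hab', ENNReal.ofReal_toReal hfin]
  calc _ ≤ _ := mul_le_mul_left h1 _
    _ ≤ _ := by rw [mul_assoc, mul_comm (lintegral _ _)]; gcongr

end WeightedGraph

/-- The weighted mean over a subset differs from `c` by at most a weighted `L²` norm of `f - c`. -/
theorem Finset.sq_weighted_mean_sub_le {ι : Type*} {A B : Finset ι} (hAB : A ⊆ B) {μ : ι → ℝ}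
    (hμ : ∀ i ∈ B, 0 ≤ μ i) (f : ι → ℝ) (c : ℝ) (hA : 0 < ∑ i ∈ A, μ i) :
    ((∑ i ∈ A, f i * μ i) / (∑ i ∈ A, μ i) - c) ^ 2 ≤
      (∑ i ∈ B, (f i - c) ^ 2 * μ i) / ∑ i ∈ A, μ i := by
  have h1 : (∑ i ∈ A, f i * μ i) / (∑ i ∈ A, μ i) - c =
      (∑ i ∈ A, (f i - c) * μ i) / ∑ i ∈ A, μ i := by
    rw [eq_div_iff hA.ne', sub_mul, div_mul_cancel₀ _ hA.ne', Finset.mul_sum,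
      ← Finset.sum_sub_distrib]
    exact Finset.sum_congr rfl fun i _ => by ring
  have h2 : (∑ i ∈ A, (f i - c) * μ i) ^ 2 ≤ (∑ i ∈ A, μ i) * ∑ i ∈ A, (f i - c) ^ 2 * μ i :=
    Finset.sum_sq_le_sum_mul_sum_of_sq_le_mul A (fun i hi => hμ i (hAB hi))
      (fun i hi => mul_nonneg (sq_nonneg _) (hμ i (hAB hi))) fun i _ => by
        apply le_of_eq; ring
  have h3 : ∑ i ∈ A, (f i - c) ^ 2 * μ i ≤ ∑ i ∈ B, (f i - c) ^ 2 * μ i :=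
    Finset.sum_le_sum_of_subset_of_nonneg hAB fun i hi _ => mul_nonneg (sq_nonneg _) (hμ i hi)
  rw [h1, div_pow, div_le_div_iff₀ (by positivity) hA]
  nlinarith

namespace WeightedGraph

variable {V : Type u} {W : WeightedGraph V}

/-! ### Weights and volumes -/

theorem finite_support_weight (x : V) : (Function.support (W.weight x)).Finite :=
  (W.locallyFinite x).subset fun y hy =>
    (W.weight_pos_iff x y).1 ((W.weight_nonneg x y).lt_of_ne (Ne.symm hy))

theorem sum_weight_le_vertexWeight (x : V) (B : Finset V) :
    ∑ y ∈ B, W.weight x y ≤ W.vertexWeight x := by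
  classical
  rw [vertexWeight, finsum_eq_sum_of_support_subset
    (s := (finite_support_weight (W := W) x).toFinset ∪ B) _ (by simp)]
  exact Finset.sum_le_sum_of_subset_of_nonneg Finset.subset_union_right
    fun y _ _ => W.weight_nonneg x y

theorem weight_le_vertexWeight (x y : V) : W.weight x y ≤ W.vertexWeight x := by
  simpa using sum_weight_le_vertexWeight (W := W) x {y}

theorem vertexWeight_pos (x : V) : 0 < W.vertexWeight x := by
  obtain ⟨y, hy⟩ := W.exists_adj x
  exact ((W.weight_pos_iff x y).2 hy).trans_le (weight_le_vertexWeight x y)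

theorem SatisfiesP0.mul_vertexWeight_le {p₀ : ℝ} (h : W.SatisfiesP0 p₀) {x y : V}
    (hxy : W.graph.Adj x y) : p₀ * W.vertexWeight x ≤ W.weight x y :=
  (le_div_iff₀ (vertexWeight_pos x)).1 (h x y hxy)

theorem graphBall_mono (x : V) {r R : ℝ} (h : r ≤ R) : W.graphBall x r ⊆ W.graphBall x R :=
  fun _ hy => le_trans (α := ℝ) hy h

theorem mem_graphBall_self (x : V) {r : ℝ} (h : 0 ≤ r) : x ∈ W.graphBall x r := by
  simpa [graphBall] using h

theorem finite_graphBall {df CV : ℝ}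
    (hV : W.SatisfiesVolumeGrowth df CV) (hCV : 1 < CV)
    (x : V) (r : ℝ) : (W.graphBall x r).Finite := by
  refine Set.Finite.subset ?_ (graphBall_mono x (le_max_left r 1))
  by_contra hinf
  have h := (hV x (max r 1) (le_max_right _ _)).1
  -- Over an infinite ball the finite sum takes its default value 0, which contradicts the lower
  -- volume bound.
  rw [graphVolume, finsum_mem_eq_zero_of_infinite] at h
  · have : 0 < max r 1 := lt_max_of_lt_right one_pos
    have : 0 < CV := by linarith
    exact absurd h (not_le.2 (by positivity))
  · convert hinf
    exact inter_eq_left.2 fun y _ => (vertexWeight_pos y).ne'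

theorem graphVolume_eq_sum {df CV : ℝ}
    (hV : W.SatisfiesVolumeGrowth df CV) (hCV : 1 < CV) (x : V) (r : ℝ) :
    W.graphVolume x r = ∑ y ∈ (finite_graphBall hV hCV x r).toFinset, W.vertexWeight y :=
  finsum_mem_eq_finite_toFinset_sum _ _

theorem vertexWeight_le_graphVolume {df CV : ℝ}
    (hV : W.SatisfiesVolumeGrowth df CV) (hCV : 1 < CV) (x : V) {r : ℝ} (hr : 0 ≤ r) :
    W.vertexWeight x ≤ W.graphVolume x r := by
  rw [graphVolume_eq_sum hV hCV]
  exact Finset.single_le_sum (f := W.vertexWeight) (fun y _ => (vertexWeight_pos y).le)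
    (by simpa using mem_graphBall_self x hr)

/-- The unit ball has volume at least CV⁻¹. By `(p₀)` each neighbour y of x has μ_y ≤ p₀⁻¹ μ(x,y),
so this volume is at most (1 + p₀⁻¹) μ_x. -/
theorem le_vertexWeight {df CV : ℝ}
    (hV : W.SatisfiesVolumeGrowth df CV) (hCV : 1 < CV)
    {p₀ : ℝ} (hp₀ : 0 < p₀) (hP : W.SatisfiesP0 p₀) (x : V) :
    CV⁻¹ / (1 + p₀⁻¹) ≤ W.vertexWeight x := by
  classical
  rw [div_le_iff₀ (by positivity)]
  have h := (hV x 1 le_rfl).1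
  rw [Real.one_rpow, mul_one, graphVolume_eq_sum hV hCV] at h
  refine h.trans ?_
  set B := (finite_graphBall hV hCV x 1).toFinset with hB
  have h1 : ∀ y ∈ B, W.vertexWeight y ≤
      (if y = x then W.vertexWeight x else 0) + W.weight x y * p₀⁻¹ := by
    intro y hy
    split_ifs with hyx
    · have := mul_nonneg (W.weight_nonneg x y) (inv_pos.2 hp₀).le
      rw [hyx] at this ⊢
      linarith
    · have hd : W.graph.dist x y ≤ 1 := by
        have : (W.graph.dist x y : ℝ) ≤ 1 := by simpa [hB, graphBall] using hy
        exact_mod_cast this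
      have hd0 : W.graph.dist x y ≠ 0 := fun h0 =>
        hyx (W.connected.dist_eq_zero_iff.1 h0).symm
      have hadj : W.graph.Adj x y := SimpleGraph.dist_eq_one_iff_adj.1 (by omega)
      rw [zero_add, ← div_eq_mul_inv, le_div_iff₀ hp₀, W.weight_symm, mul_comm]
      exact hP.mul_vertexWeight_le hadj.symm
  refine (Finset.sum_le_sum h1).trans ?_
  rw [Finset.sum_add_distrib, ← Finset.sum_mul, Finset.sum_ite_eq', mul_add, mul_one]
  gcongr
  · split_ifs
    · exact le_rfl
    · exact (vertexWeight_pos x).le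
  · exact sum_weight_le_vertexWeight x B

theorem le_weight {df CV : ℝ}
    (hV : W.SatisfiesVolumeGrowth df CV) (hCV : 1 < CV)
    {p₀ : ℝ} (hp₀ : 0 < p₀) (hP : W.SatisfiesP0 p₀) (e : W.Edge) :
    p₀ * (CV⁻¹ / (1 + p₀⁻¹)) ≤ W.weight (src e) (tgt e) :=
  (mul_le_mul_of_nonneg_left (le_vertexWeight hV hCV hp₀ hP (src e)) hp₀.le).trans
    (hP.mul_vertexWeight_le (adj_src_tgt e))

/-- A lower volume bound for half of the radius that also covers balls reduced to a point. -/
theorem le_graphVolume_half {df CV : ℝ}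
    (hV : W.SatisfiesVolumeGrowth df CV) (hCV : 1 < CV)
    {p₀ : ℝ} (hp₀ : 0 < p₀) (hP : W.SatisfiesP0 p₀) (x : V) {r : ℝ}
    (hr : 1 ≤ r) :
    CV⁻¹ / (1 + p₀⁻¹) * (2 ^ |df|)⁻¹ * r ^ df ≤ W.graphVolume x (r / 2) := by
  have hCV0 : 0 < CV := by linarith
  have hr0 : 0 < r := by linarith
  rcases le_or_gt 2 r with h2 | h2
  · refine le_trans ?_ (hV x (r / 2) (by linarith)).1
    rw [Real.div_rpow hr0.le two_pos.le, mul_assoc, div_eq_mul_inv (r ^ df), mul_comm (r ^ df)]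
    gcongr
    · exact div_le_self (by positivity) (by linarith [inv_pos.2 hp₀])
    · norm_num
    · exact le_abs_self df
  -- Here r/2 < 1 and the volume hypothesis says nothing, so the weight of the center has to
  -- suffice; r ^ df is at most 2 ^ |df|.
  · refine le_trans ?_ (vertexWeight_le_graphVolume hV hCV x (by linarith))
    refine le_trans ?_ (le_vertexWeight hV hCV hp₀ hP x)
    rw [mul_assoc]
    refine mul_le_of_le_one_right (by positivity) ?_
    rw [inv_mul_le_iff₀ (by positivity), mul_one]
    calc r ^ df ≤ r ^ |df| := Real.rpow_le_rpow_of_exponent_le hr (le_abs_self df)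
      _ ≤ 2 ^ |df| := Real.rpow_le_rpow hr0.le h2.le (abs_nonneg _)

/-! ### Comparison of energies -/

/-- Along each edge the squared increment of u is at most the energy of that edge. The double sum
meets each edge in both orientations, whence the factor 2. -/
theorem graphEnergy_le {df CV : ℝ}
    (hV : W.SatisfiesVolumeGrowth df CV) (hCV : 1 < CV)
    {D S : Set W.Cable} {u : W.Cable → ℝ} (hu : IsInReflectedDomain D u)
    (hS : MeasurableSet S) (hSD : S ⊆ D) (hfin : energyOn S u ≠ ⊤) (v : V) (R : ℝ)
    (hvS : ∀ e : W.Edge, src e ∈ W.graphBall v R → ∀ t ∈ Icc (0 : ℝ) 1, edgePath e t ∈ S) :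
    ∑ᶠ x ∈ W.graphBall v R, ∑ᶠ y ∈ W.graphBall v R,
      (u (W.vtx x) - u (W.vtx y)) ^ 2 * W.weight x y ≤ 2 * (energyOn S u).toReal := by
  classical
  set B := (finite_graphBall hV hCV v R).toFinset with hB
  have hmem : ∀ x, x ∈ B ↔ x ∈ W.graphBall v R := fun x => by simp [hB]
  set G : V × V → ENNReal := fun p =>
    ENNReal.ofReal ((u (W.vtx p.1) - u (W.vtx p.2)) ^ 2 * W.weight p.1 p.2) with hG
  have hnn : ∀ x y, 0 ≤ (u (W.vtx x) - u (W.vtx y)) ^ 2 * W.weight x y := fun x y =>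
    mul_nonneg (sq_nonneg _) (W.weight_nonneg x y)
  have hinj : Function.Injective fun e : W.Edge => (src e, tgt e) := fun e e' h => by
    simp only [Prod.mk.injEq] at h
    exact Subtype.ext (by rw [edge_eq e, edge_eq e', h.1, h.2])
  have hinj' : Function.Injective fun e : W.Edge => (tgt e, src e) :=
    Prod.swap_injective.comp hinj
  set T : Finset W.Edge := (B ×ˢ B).preimage (fun e : W.Edge => (src e, tgt e)) hinj.injOn with hT
  have hsub : ∑ p ∈ B ×ˢ B, G p ≤
      ∑ p ∈ T.image (fun e => (src e, tgt e)) ∪ T.image (fun e => (tgt e, src e)), G p := by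
    refine Finset.sum_le_sum_of_ne_zero fun p hp hp0 => ?_
    have hadj : W.graph.Adj p.1 p.2 := by
      rw [← W.weight_pos_iff]
      refine (W.weight_nonneg _ _).lt_of_ne fun h0 => hp0 ?_
      simp [hG, ← h0]
    obtain ⟨hp1, hp2⟩ := Finset.mem_product.1 hp
    obtain ⟨e, ⟨h1, h2⟩ | ⟨h1, h2⟩⟩ := exists_edge_eq hadj
    · refine Finset.mem_union_left _ (Finset.mem_image.2 ⟨e, ?_, by rw [h1, h2]⟩)
      simp [hT, h1, h2, hp1, hp2]
    · refine Finset.mem_union_right _ (Finset.mem_image.2 ⟨e, ?_, by rw [h1, h2]⟩)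
      simp [hT, h1, h2, hp1, hp2]
  have hunion : ∑ p ∈ T.image (fun e => (src e, tgt e)) ∪ T.image (fun e => (tgt e, src e)), G p ≤
      2 * ∑ e ∈ T, G (src e, tgt e) := by
    -- Adding the sum over the intersection makes disjointness of the two orientations unnecessary.
    refine le_self_add.trans (Finset.sum_union_inter.le.trans ?_)
    rw [Finset.sum_image hinj.injOn, Finset.sum_image hinj'.injOn, two_mul]
    refine add_le_add le_rfl (Finset.sum_le_sum fun e _ => le_of_eq ?_)
    simp only [hG]
    rw [W.weight_symm, ← neg_sub (u _), neg_sq]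
  have hedge : ∀ e ∈ T, G (src e, tgt e) ≤ ENNReal.ofReal (W.weight (src e) (tgt e)) *
      ∫⁻ t in Ioo (0 : ℝ) 1, ENNReal.ofReal (deriv (fun t => u (edgePath e t)) t ^ 2) := by
    intro e he
    have heB : src e ∈ W.graphBall v R := by
      rw [← hmem]
      simp only [hT, Finset.mem_preimage, Finset.mem_product] at he
      exact he.1
    have h := hu.sq_sub_le_lintegral e le_rfl zero_le_one le_rfl fun t ht => hSD (hvS e heB t ht)
    rw [sub_zero, ENNReal.ofReal_one, one_mul, edgePath_one, edgePath_zero] at h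
    simp only [hG]
    rw [mul_comm, ENNReal.ofReal_mul (weight_pos e).le, ← neg_sub (u _), neg_sq]
    gcongr
  have henergy := sum_le_energyOn hS u T (J := Ioo 0 1) measurableSet_Ioo subset_rfl
      fun e he t ht =>
    hvS e (by
      rw [← hmem]
      simp only [hT, Finset.mem_preimage, Finset.mem_product] at he
      exact he.1) t (Ioo_subset_Icc_self ht)
  have htotal : ∑ p ∈ B ×ˢ B, G p ≤ 2 * energyOn S u :=
    (hsub.trans hunion).trans (mul_le_mul_right ((Finset.sum_le_sum hedge).trans henergy) _)
  have hreal : ∑ᶠ x ∈ W.graphBall v R, ∑ᶠ y ∈ W.graphBall v R,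
      (u (W.vtx x) - u (W.vtx y)) ^ 2 * W.weight x y =
      ∑ p ∈ B ×ˢ B, (u (W.vtx p.1) - u (W.vtx p.2)) ^ 2 * W.weight p.1 p.2 := by
    rw [finsum_mem_eq_finite_toFinset_sum _ (finite_graphBall hV hCV v R), Finset.sum_product]
    exact Finset.sum_congr rfl fun x _ =>
      finsum_mem_eq_finite_toFinset_sum _ (finite_graphBall hV hCV v R)
  rw [hreal]
  refine (ENNReal.ofReal_le_ofReal_iff (by positivity)).1 ?_
  rw [ENNReal.ofReal_sum_of_nonneg fun p _ => hnn _ _, ENNReal.ofReal_mul two_pos.le,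
    ENNReal.ofReal_toReal hfin, ENNReal.ofReal_ofNat]
  exact htotal

/-- Means over nested balls are compared by means of the Poincaré inequality. -/
theorem sq_graphMean_sub_le {df CV : ℝ}
    (hV : W.SatisfiesVolumeGrowth df CV) (hCV : 1 < CV)
    {dw CP : ℝ} (hPI : W.SatisfiesPoincare dw CP) (hCP : 1 < CP)
    {D S : Set W.Cable} {u : W.Cable → ℝ}
    (hu : IsInReflectedDomain D u) (hS : MeasurableSet S) (hSD : S ⊆ D) (hfin : energyOn S u ≠ ⊤)
    {v v' : V} {ρ ρ' : ℝ} (hρ : 0 < ρ) (hρ' : 0 ≤ ρ')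
    (hsub : W.graphBall v' ρ' ⊆ W.graphBall v ρ)
    (hvS : ∀ e : W.Edge, src e ∈ W.graphBall v (2 * ρ) →
      ∀ t ∈ Icc (0 : ℝ) 1, edgePath e t ∈ S) :
    (W.graphMean (fun x => u (W.vtx x)) v' ρ' - W.graphMean (fun x => u (W.vtx x)) v ρ) ^ 2 ≤
      CP * ρ ^ dw * (2 * (energyOn S u).toReal) / W.graphVolume v' ρ' := by
  set f : V → ℝ := fun x => u (W.vtx x) with hf
  have hpos : 0 < W.graphVolume v' ρ' :=
    (vertexWeight_pos v').trans_le (vertexWeight_le_graphVolume hV hCV v' hρ')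
  have hP := hPI v ρ hρ.le f
  rw [finsum_mem_eq_finite_toFinset_sum _ (finite_graphBall hV hCV v ρ)] at hP
  have h1 := Finset.sq_weighted_mean_sub_le
    (A := (finite_graphBall hV hCV v' ρ').toFinset) (B := (finite_graphBall hV hCV v ρ).toFinset)
    (Set.Finite.toFinset_subset_toFinset.2 hsub) (μ := W.vertexWeight)
    (fun i _ => (vertexWeight_pos i).le) f (W.graphMean f v ρ)
    (by rwa [← graphVolume_eq_sum hV hCV])
  rw [← graphVolume_eq_sum hV hCV, ← finsum_mem_eq_finite_toFinset_sum _] at h1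
  refine h1.trans ?_
  gcongr
  refine hP.trans ?_
  gcongr
  exact graphEnergy_le hV hCV hu hS hSD hfin v (2 * ρ) hvS

/-! ### Small scales -/

theorem IsInReflectedDomain.energyOn_ne_top {D S : Set W.Cable} {u : W.Cable → ℝ}
    (hu : IsInReflectedDomain D u) (hSD : S ⊆ D) : energyOn S u ≠ ⊤ :=
  ne_top_of_le_ne_top (ENNReal.add_lt_top.1 hu.2.2).2.ne (lintegral_mono_set hSD)

theorem IsInReflectedDomain.abs_sub_le_sqrt {D S : Set W.Cable} {u : W.Cable → ℝ}
    (hu : IsInReflectedDomain D u) (hS : MeasurableSet S) (hSD : S ⊆ D)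
    {ω : ℝ} (hω : 0 < ω) (hle : ∀ e : W.Edge, ω ≤ W.weight (src e) (tgt e)) (e : W.Edge)
    {a b ℓ : ℝ} (ha : a ∈ Icc (0 : ℝ) 1) (hb : b ∈ Icc (0 : ℝ) 1) (hab : |b - a| ≤ ℓ)
    (hseg : ∀ t ∈ uIcc a b, edgePath e t ∈ S) :
    |u (edgePath e b) - u (edgePath e a)| ≤ √(ℓ * (energyOn S u).toReal / ω) := by
  wlog h : a ≤ b generalizing a b
  · rw [abs_sub_comm] at hab ⊢
    exact this hb ha hab (by rwa [uIcc_comm]) (le_of_not_ge h)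
  rw [uIcc_of_le h] at hseg
  rw [abs_of_nonneg (sub_nonneg.2 h)] at hab
  apply Real.abs_le_sqrt
  rw [le_div_iff₀ hω]
  calc _ ≤ (u (edgePath e b) - u (edgePath e a)) ^ 2 * W.weight (src e) (tgt e) := by
        gcongr; exact hle e
    _ ≤ (b - a) * (energyOn S u).toReal :=
        hu.sq_sub_mul_weight_le hS (hu.energyOn_ne_top hSD) e ha.1 h hb.2
          (fun t ht => hSD (hseg t ht)) hseg
    _ ≤ _ := by gcongr

/-- Since r ≤ 2, a path of length below r contains at most one full edge between its first and last
vertex. It thus has at most three pieces: x to a vertex a, a to b, and b to y. Each has length at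
most r and contributes at most κ. -/
theorem IsInReflectedDomain.abs_sub_le_of_dist_lt {x : W.Cable} {r : ℝ} (hr : 0 < r) (hr2 : r ≤ 2)
    {u : W.Cable → ℝ} (hu : IsInReflectedDomain (Metric.ball x (9 * r)) u)
    {ω : ℝ} (hω : 0 < ω) (hle : ∀ e : W.Edge, ω ≤ W.weight (src e) (tgt e))
    {y : W.Cable} (hy : dist y x < r) :
    |u y - u x| ≤ 3 * √(r * (energyOn (Metric.ball x (9 * r)) u).toReal / ω) := by
  set κ := √(r * (energyOn (Metric.ball x (9 * r)) u).toReal / ω) with hκ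
  have hκ0 : 0 ≤ κ := Real.sqrt_nonneg _
  -- A segment of length at most r that starts within 8r of x stays in the ball of radius 9r.
  have hseg : ∀ (e : W.Edge) (a b : ℝ), a ∈ Icc (0 : ℝ) 1 → b ∈ Icc (0 : ℝ) 1 → |b - a| ≤ r →
      dist (edgePath e a) x < 8 * r → |u (edgePath e b) - u (edgePath e a)| ≤ κ := by
    intro e a b ha hb hab hd
    refine hu.abs_sub_le_sqrt Metric.isOpen_ball.measurableSet subset_rfl hω hle e ha hb hab
      fun t ht => ?_
    have h1 := dist_triangle (edgePath e t) (edgePath e a) x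
    have h2 := dist_edgePath_le e t a
    have h3 := abs_sub_left_of_mem_uIcc ht
    rw [Metric.mem_ball]
    linarith
  have hsrc : ∀ (e : W.Edge) (t : ℝ), t ∈ Icc (0 : ℝ) 1 → t ≤ r → dist (edgePath e t) x < 8 * r →
      |u (W.vtx (src e)) - u (edgePath e t)| ≤ κ := fun e t ht htr hd => by
    rw [← edgePath_zero]
    exact hseg e t 0 ht (by simp) (by rwa [zero_sub, abs_neg, abs_of_nonneg ht.1]) hd
  have htgt : ∀ (e : W.Edge) (t : ℝ), t ∈ Icc (0 : ℝ) 1 → 1 - t ≤ r →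
      dist (edgePath e t) x < 8 * r → |u (W.vtx (tgt e)) - u (edgePath e t)| ≤ κ :=
      fun e t ht htr hd => by
    rw [← edgePath_one]
    exact hseg e t 1 ht (by simp) (by rwa [abs_of_nonneg (by linarith [ht.2])]) hd
  obtain ⟨e₀, s₀, hs₀, rfl⟩ := exists_edgePath_eq x
  obtain ⟨e, t, ht, rfl⟩ := exists_edgePath_eq y
  have hnn : ∀ b, 0 ≤ vertexDistFrom e₀ s₀ b := fun b =>
    le_min (by linarith [hs₀.1, (W.graph.dist (src e₀) b).cast_nonneg (α := ℝ)])
      (by linarith [hs₀.2, (W.graph.dist (tgt e₀) b).cast_nonneg (α := ℝ)])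
  have hself : dist (edgePath e₀ s₀) (edgePath e₀ s₀) < 8 * r := by
    rw [dist_self]; positivity
  have hfar : ∀ b, vertexDistFrom e₀ s₀ b < r → |u (W.vtx b) - u (edgePath e₀ s₀)| ≤ 2 * κ := by
    intro b hb
    have hkey : ∃ a, |u (W.vtx a) - u (edgePath e₀ s₀)| ≤ κ ∧ (W.graph.dist a b : ℝ) < r ∧
        dist (W.vtx a) (edgePath e₀ s₀) < 8 * r := by
      rcases min_lt_iff.1 hb with h | h
      · have h0 := (W.graph.dist (src e₀) b).cast_nonneg (α := ℝ)
        refine ⟨src e₀, hsrc e₀ s₀ hs₀ (by linarith) hself, by linarith [hs₀.1], ?_⟩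
        rw [dist_comm, dist_edgePath_vtx_src e₀ hs₀]
        linarith
      · have h0 := (W.graph.dist (tgt e₀) b).cast_nonneg (α := ℝ)
        refine ⟨tgt e₀, htgt e₀ s₀ hs₀ (by linarith) hself, by linarith [hs₀.2], ?_⟩
        rw [dist_comm, dist_edgePath_vtx_tgt e₀ hs₀]
        linarith
    obtain ⟨a, ha, hab, hax⟩ := hkey
    have hlt : W.graph.dist a b < 2 := by exact_mod_cast hab.trans_le hr2
    have hstep : |u (W.vtx b) - u (W.vtx a)| ≤ κ := by
      rcases Nat.lt_succ_iff_lt_or_eq.1 hlt with h | h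
      · rw [W.connected.dist_eq_zero_iff.1 (Nat.lt_one_iff.1 h), sub_self, abs_zero]
        exact hκ0
      · rw [h] at hab
        obtain ⟨e', ⟨rfl, rfl⟩ | ⟨rfl, rfl⟩⟩ :=
          exists_edge_eq (SimpleGraph.dist_eq_one_iff_adj.1 h)
        · rw [← edgePath_zero] at hax ⊢
          exact htgt e' 0 (by simp) (by simpa using hab.le) hax
        · rw [← edgePath_one] at hax ⊢
          exact hsrc e' 1 (by simp) (by simpa using hab.le) hax
    have := abs_sub_le (u (W.vtx b)) (u (W.vtx a)) (u (edgePath e₀ s₀))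
    linarith
  have hd := (edgeDistFrom_le_dist e₀ hs₀ e ht).trans_lt (by rwa [dist_comm])
  have hy8 : dist (edgePath e t) (edgePath e₀ s₀) < 8 * r := by linarith
  have houter : outerDistFrom e₀ s₀ e t < r →
      |u (edgePath e t) - u (edgePath e₀ s₀)| ≤ 3 * κ := by
    intro h
    rcases min_lt_iff.1 h with h | h
    · have h1 := hfar (src e) (by linarith [ht.1])
      have h2 := hsrc e t ht (by linarith [hnn (src e)]) hy8
      rw [abs_sub_comm] at h2
      have := abs_sub_le (u (edgePath e t)) (u (W.vtx (src e))) (u (edgePath e₀ s₀))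
      linarith
    · have h1 := hfar (tgt e) (by linarith [ht.2])
      have h2 := htgt e t ht (by linarith [hnn (tgt e)]) hy8
      rw [abs_sub_comm] at h2
      have := abs_sub_le (u (edgePath e t)) (u (W.vtx (tgt e))) (u (edgePath e₀ s₀))
      linarith
  rw [edgeDistFrom] at hd
  split_ifs at hd with he
  · subst he
    rcases min_lt_iff.1 hd with h | h
    · have := hseg e s₀ t hs₀ ht h.le hself
      linarith
    · exact houter h
  · exact houter hd

/-- The energy bound at scales of at most the size of two edges. -/
theorem IsInReflectedDomain.le_mul_energyOn {x : W.Cable} {r : ℝ} (hr : 0 < r) (hr2 : r ≤ 2)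
    {u : W.Cable → ℝ} (hu : IsInReflectedDomain (Metric.ball x (9 * r)) u)
    {ω : ℝ} (hω : 0 < ω) (hle : ∀ e : W.Edge, ω ≤ W.weight (src e) (tgt e))
    {y z : W.Cable} (hy : dist y x < r) (hz : dist z x < r) (hy1 : u y = 1) (hz0 : u z = 0) :
    ω ≤ 36 * (r * (energyOn (Metric.ball x (9 * r)) u).toReal) := by
  have h1 := hu.abs_sub_le_of_dist_lt hr hr2 hω hle hy
  have h2 := hu.abs_sub_le_of_dist_lt hr hr2 hω hle hz
  rw [hy1] at h1
  rw [hz0] at h2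
  -- The values 1 and 0 differ from u x by at most 3κ each, so 1 ≤ 6κ.
  have h3 : 1 / 6 ≤ √(r * (energyOn (Metric.ball x (9 * r)) u).toReal / ω) := by
    linarith [le_abs_self (1 - u x), neg_abs_le (0 - u x)]
  have h4 := (Real.le_sqrt' (by norm_num)).1 h3
  rw [le_div_iff₀ hω] at h4
  linarith

end WeightedGraph

/-! ### Hausdorff content and coverings -/

/-- Lets covers be indexed by their centers, as Vitali's lemma provides them, instead of by natural
numbers. -/
theorem hausdorffContent_le_tsum {X : Type*} [PseudoMetricSpace X] [Nonempty X] (s : ℝ)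
      {A J : Set X}
    (hJ : J.Countable) {ρ : X → ℝ} (hρ : ∀ y ∈ J, 0 < ρ y)
    (hA : A ⊆ ⋃ y ∈ J, Metric.ball y (ρ y)) :
    hausdorffContent s A ≤ ∑' y : J, ENNReal.ofReal (ρ y ^ s) := by
  obtain ⟨x₀⟩ := ‹Nonempty X›
  have := hJ.to_subtype
  obtain ⟨f, hf⟩ := exists_injective_nat J
  have hinv : ∀ y : J, Function.extend f (fun y : J => (y : X)) (fun _ => x₀) (f y) = y :=
    fun y => hf.extend_apply _ _ y
  set c : ℕ → X := Function.extend f (fun y : J => (y : X)) (fun _ => x₀) with hc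
  have htsum : ∑' i : range f, ENNReal.ofReal (ρ (c i) ^ s) =
      ∑' y : J, ENNReal.ofReal (ρ y ^ s) := by
    rw [← (Equiv.ofInjective f hf).tsum_eq]
    simp [hinv]
  rw [← htsum]
  refine iInf_le_of_le (range f) (iInf_le_of_le c (iInf_le_of_le (fun n => ρ (c n))
    (iInf_le_of_le ?_ (iInf_le_of_le ?_ le_rfl))))
  · rintro _ ⟨y, rfl⟩
    simpa only [hinv] using hρ y y.2
  · intro a ha
    obtain ⟨y, hy, hay⟩ := mem_iUnion₂.1 (hA ha)
    refine mem_iUnion₂.2 ⟨f ⟨y, hy⟩, mem_range_self _, ?_⟩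
    simpa only [hinv] using hay

theorem nonempty_of_hausdorffContent_pos {X : Type*} [PseudoMetricSpace X] [Nonempty X] {s : ℝ}
    {A : Set X} (h : 0 < hausdorffContent s A) : A.Nonempty := by
  by_contra hA
  rw [not_nonempty_iff_eq_empty] at hA
  have h1 := hausdorffContent_le_tsum s (A := A) (J := ∅) countable_empty (ρ := fun _ => 1)
    (by simp) (by simp [hA])
  rw [tsum_empty] at h1
  exact h.not_ge h1

/-- If every point of `A` is the center of a ball that carries a large part of the finite measure
`ν`, then the content of `A` is controlled by the total mass of `ν`. -/
theorem hausdorffContent_le_mul_measure_univ {X : Type*} [PseudoMetricSpace X] [MeasurableSpace X]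
    [OpensMeasurableSpace X] [Nonempty X] (ν : Measure X) [IsFiniteMeasure ν] {s κ R : ℝ}
      (hκ : 0 < κ)
    {A : Set X} {ρ : X → ℝ} (hρ : ∀ y ∈ A, 0 < ρ y) (hR : ∀ y ∈ A, ρ y ≤ R)
    (hν : ∀ y ∈ A, ENNReal.ofReal (κ * ρ y ^ s) ≤ ν (Metric.closedBall y (4 * ρ y))) :
    hausdorffContent s A ≤ ENNReal.ofReal (21 ^ s / κ) * ν univ := by
  -- The enlargement factor 5 yields closed balls of radius 20ρ; the radius 21ρ below makes them
  -- open.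
  obtain ⟨J, hJA, hdisj, hcov⟩ := Vitali.exists_disjoint_subfamily_covering_enlargement_closedBall
    A (fun y => y) (fun y => 4 * ρ y) (4 * R) (fun y hy => by linarith [hR y hy]) 5 (by norm_num)
  have hmeas : ∀ y : J, MeasurableSet (Metric.closedBall (y : X) (4 * ρ y)) := fun y =>
    Metric.isClosed_closedBall.measurableSet
  have hdisj' : Pairwise (Function.onFun Disjoint fun y : J =>
      Metric.closedBall (y : X) (4 * ρ y)) := fun y z hyz =>
    hdisj y.2 z.2 fun h => hyz (Subtype.ext h)
  have hpos : ∀ y : J, 0 < ν (Metric.closedBall (y : X) (4 * ρ y)) := fun y =>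
    (ENNReal.ofReal_pos.2 (by have := hρ y (hJA y.2); positivity)).trans_le (hν y (hJA y.2))
  -- A finite measure charges only countably many disjoint sets, so separability is not needed.
  have hcount : J.Countable := by
    have h := Measure.countable_meas_pos_of_disjoint_iUnion (μ := ν) hmeas hdisj'
    rw [Set.eq_univ_of_forall (s := {i : J | 0 < ν (Metric.closedBall (i : X) (4 * ρ i))})
      hpos] at h
    exact countable_univ_iff.1 h
  have := hcount.to_subtype
  calc hausdorffContent s A
      ≤ ∑' y : J, ENNReal.ofReal ((21 * ρ y) ^ s) := by
        refine hausdorffContent_le_tsum s (ρ := fun y => 21 * ρ y) hcount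
          (fun y hy => by have := hρ y (hJA hy); positivity) fun a ha => ?_
        obtain ⟨b, hb, hab⟩ := hcov a ha
        refine mem_iUnion₂.2 ⟨b, hb, ?_⟩
        have h1 := hab (Metric.mem_closedBall_self (by have := hρ a ha; positivity))
        have h2 := hρ b (hJA hb)
        rw [Metric.mem_closedBall] at h1
        rw [Metric.mem_ball]
        linarith
    _ ≤ ∑' y : J, ENNReal.ofReal (21 ^ s / κ) * ν (Metric.closedBall (y : X) (4 * ρ y)) := by
        refine ENNReal.tsum_le_tsum fun y => ?_
        have h2 := hρ y (hJA y.2)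
        refine le_trans (le_of_eq ?_) (mul_le_mul_right (hν y (hJA y.2)) _)
        rw [← ENNReal.ofReal_mul (by positivity), Real.mul_rpow (by norm_num) h2.le]
        congr 1
        field_simp
    _ ≤ ENNReal.ofReal (21 ^ s / κ) * ν univ := by
        rw [ENNReal.tsum_mul_left]
        gcongr
        exact tsum_meas_le_meas_iUnion_of_disjoint _ hmeas hdisj' |>.trans
          (measure_mono (subset_univ _))

namespace WeightedGraph

variable {V : Type u} {W : WeightedGraph V}

/-! ### Comparison of means across scales -/

theorem graphMean_of_lt_one (f : V → ℝ) (v : V) {r : ℝ} (hr0 : 0 ≤ r) (hr : r < 1) :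
    W.graphMean f v r = f v := by
  have hball : W.graphBall v r = {v} := by
    ext w
    refine ⟨fun hw => ?_, fun hw => by rw [mem_singleton_iff.1 hw]; exact mem_graphBall_self v hr0⟩
    have h1 : (W.graph.dist v w : ℝ) < 1 := lt_of_le_of_lt (α := ℝ) hw hr
    have h2 : W.graph.dist v w = 0 := Nat.lt_one_iff.1 (by exact_mod_cast h1)
    exact (W.connected.dist_eq_zero_iff.1 h2).symm
  rw [graphMean, graphVolume, hball, finsum_mem_singleton, finsum_mem_singleton,
    mul_div_cancel_right₀ _ (vertexWeight_pos v).ne']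

theorem dist_edgePath_le_of_src_mem {v : V} {R : ℝ} {y : W.Cable} (hy : dist y (W.vtx v) ≤ 1)
    {e : W.Edge} (he : src e ∈ W.graphBall v R) {t : ℝ} (ht : t ∈ Icc (0 : ℝ) 1) :
    dist (edgePath e t) y ≤ R + 2 := by
  have h1 := dist_triangle4 (edgePath e t) (W.vtx (src e)) (W.vtx v) y
  rw [dist_edgePath_vtx_src e ht, dist_comm (W.vtx v) y, dist_comm (W.vtx (src e))] at h1
  have h2 := dist_vtx_le (W := W) v (src e)
  have h3 : (W.graph.dist v (src e) : ℝ) ≤ R := he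
  linarith [ht.2]

/-- The Poincaré inequality at radius ρ involves edges issuing from the ball of radius 2ρ around v.
These lie within 2ρ + 2 ≤ 4ρ of y, which is where the factor 4 and the condition ρ ≥ 1 come from. -/
theorem sq_graphMean_half_sub_le {df dw CV CP p₀ : ℝ} (hp₀ : 0 < p₀)
    (hCV : 1 < CV) (hCP : 1 < CP) (hP : W.SatisfiesP0 p₀) (hV : W.SatisfiesVolumeGrowth df CV)
    (hPI : W.SatisfiesPoincare dw CP) {D : Set W.Cable} {u : W.Cable → ℝ}
    (hu : IsInReflectedDomain D u) {y : W.Cable} {v : V} (hy : dist y (W.vtx v) ≤ 1) {ρ : ℝ}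
    (hρ : 1 ≤ ρ) (hD : Metric.closedBall y (4 * ρ) ⊆ D) :
    (W.graphMean (fun x => u (W.vtx x)) v (ρ / 2) - W.graphMean (fun x => u (W.vtx x)) v ρ) ^ 2 ≤
      2 * CP / (CV⁻¹ / (1 + p₀⁻¹) * (2 ^ |df|)⁻¹) * ρ ^ (dw - df) *
        (energyOn (Metric.closedBall y (4 * ρ)) u).toReal := by
  have hρ0 : 0 < ρ := by linarith
  have hCV0 : 0 < CV := by linarith
  have h := sq_graphMean_sub_le hV hCV hPI hCP hu
    (Metric.isClosed_closedBall (x := y) (ε := 4 * ρ)).measurableSet hD (hu.energyOn_ne_top hD)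
    (v := v) (v' := v) (ρ := ρ) (ρ' := ρ / 2) hρ0 (by linarith)
    (graphBall_mono v (by linarith)) (fun e he t ht => by
      have := dist_edgePath_le_of_src_mem hy he ht
      rw [Metric.mem_closedBall]
      linarith)
  have hvol := le_graphVolume_half hV hCV hp₀ hP v hρ
  set κ := CV⁻¹ / (1 + p₀⁻¹) * (2 ^ |df|)⁻¹ with hκ
  have hκ0 : 0 < κ := by positivity
  refine h.trans ((div_le_div_of_nonneg_left (by positivity) (by positivity) hvol).trans
    (le_of_eq ?_))
  rw [Real.rpow_sub hρ0]
  field_simp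

/-- As r ≥ 2, the vertices v₀ and v are at distance at most r + 2 ≤ 2r, so the ball of radius 3r
around v₀ contains that of radius r around v. The Poincaré inequality then uses edges within 6r + 2
< 9r of x. -/
theorem sq_graphMean_sub_graphMean_three_mul_le {df dw CV CP : ℝ}
    (hCV : 1 < CV) (hCP : 1 < CP) (hV : W.SatisfiesVolumeGrowth df CV)
    (hPI : W.SatisfiesPoincare dw CP) {x : W.Cable} {r : ℝ} (hr : 2 ≤ r)
    {u : W.Cable → ℝ} (hu : IsInReflectedDomain (Metric.ball x (9 * r)) u) {v₀ v : V}
    (hx : dist x (W.vtx v₀) ≤ 1) {y : W.Cable} (hy : dist y (W.vtx v) ≤ 1) (hyx : dist y x < r) :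
    (W.graphMean (fun x => u (W.vtx x)) v r - W.graphMean (fun x => u (W.vtx x)) v₀ (3 * r)) ^ 2 ≤
      2 * CP * 3 ^ dw * CV * r ^ (dw - df) * (energyOn (Metric.ball x (9 * r)) u).toReal := by
  have hr0 : 0 < r := by linarith
  have hCV0 : 0 < CV := by linarith
  have hdist : (W.graph.dist v₀ v : ℝ) ≤ 2 * r := by
    refine (graphDist_le_dist_vtx v₀ v).trans ?_
    have h1 := dist_triangle4 (W.vtx v₀) x y (W.vtx v)
    rw [dist_comm (W.vtx v₀) x, dist_comm x y] at h1
    linarith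
  have h := sq_graphMean_sub_le hV hCV hPI hCP hu
    (Metric.isOpen_ball (x := x) (ε := 9 * r)).measurableSet subset_rfl
    (hu.energyOn_ne_top subset_rfl) (v := v₀) (v' := v) (ρ := 3 * r) (ρ' := r) (by linarith) hr0.le
    (fun w hw => by
      have h1 : (W.graph.dist v w : ℝ) ≤ r := hw
      have h2 : (W.graph.dist v₀ w : ℝ) ≤ W.graph.dist v₀ v + W.graph.dist v w := by
        exact_mod_cast W.connected.dist_triangle
      change (W.graph.dist v₀ w : ℝ) ≤ 3 * r
      linarith)
    (fun e he t ht => by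
      have := dist_edgePath_le_of_src_mem hx he ht
      rw [Metric.mem_ball]
      linarith)
  have hvol := (hV v r (by linarith)).1
  refine h.trans ((div_le_div_of_nonneg_left (by positivity) (by positivity) hvol).trans
    (le_of_eq ?_))
  rw [Real.rpow_sub hr0, Real.mul_rpow (by norm_num) hr0.le]
  field_simp

end WeightedGraph

/-! ### Elementary inequalities for the chaining -/

theorem abs_le_sqrt_mul {z A a : ℝ} (hA : 0 ≤ A) (ha : 0 ≤ a) (h : z ^ 2 ≤ A * a ^ 2) :
    |z| ≤ √A * a :=
  abs_le_of_sq_le_sq (by rwa [mul_pow, Real.sq_sqrt hA]) (by positivity)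

/-- Energies control squared increments, so the gain per scale is written as a square; its root is a
geometric sequence of ratio 2^(-δ/2). -/
theorem inv_two_pow_rpow (k : ℕ) (δ : ℝ) :
    (((2 : ℝ) ^ k)⁻¹) ^ δ = (((2 : ℝ) ^ (-(δ / 2))) ^ k) ^ 2 := by
  rw [← pow_mul, ← Real.rpow_natCast (2 ^ (-(δ / 2))), ← Real.rpow_mul two_pos.le,
    ← Real.rpow_natCast, ← Real.rpow_neg two_pos.le, ← Real.rpow_mul two_pos.le]
  congr 1
  push_cast
  ring

theorem rpow_le_two_rpow_abs {ρ τ : ℝ} (h1 : 1 ≤ ρ) (h2 : ρ ≤ 2) : ρ ^ τ ≤ 2 ^ |τ| :=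
  (Real.rpow_le_rpow_of_exponent_le h1 (le_abs_self τ)).trans
    (Real.rpow_le_rpow (by linarith) h2 (abs_nonneg _))

namespace WeightedGraph

/-! ### The dichotomy at a point -/

/-- If `u` differs at `y` from its mean over a large ball, then either the total energy is large
or some ball centered at `y` carries much energy. -/
theorem exists_energyOn_closedBall_ge {p₀ CV CP s df dw : ℝ} (hp₀ : 0 < p₀) (hCV : 1 < CV)
    (hCP : 1 < CP) (hs : df - dw < s) :
    ∃ c : ℝ, 0 < c ∧ ∀ (V : Type u) (W : WeightedGraph V),
      W.SatisfiesP0 p₀ → W.SatisfiesVolumeGrowth df CV → W.SatisfiesPoincare dw CP →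
      ∀ (x : W.Cable) (r : ℝ), 2 ≤ r →
      ∀ u : W.Cable → ℝ, IsInReflectedDomain (Metric.ball x (9 * r)) u →
      ∀ v₀ : V, dist x (W.vtx v₀) ≤ 1 → ∀ y : W.Cable, dist y x < r →
      1 / 2 ≤ |u y - W.graphMean (fun v => u (W.vtx v)) v₀ (3 * r)| →
      c * r ^ (df - dw) ≤ (energyOn (Metric.ball x (9 * r)) u).toReal ∨
      ∃ ρ : ℝ, 1 ≤ ρ ∧ ρ ≤ r ∧
        c * (ρ / r) ^ s * r ^ (df - dw) ≤ (energyOn (Metric.closedBall y (4 * ρ)) u).toReal := by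
  have hCV0 : 0 < CV := by linarith
  set ω := p₀ * (CV⁻¹ / (1 + p₀⁻¹)) with hω
  have hω0 : 0 < ω := by positivity
  set α := 2 * CP / (CV⁻¹ / (1 + p₀⁻¹) * (2 ^ |df|)⁻¹) with hα
  have hα0 : 0 ≤ α := by positivity
  set β := (2 : ℝ) ^ |df - dw| / ω with hβ
  have hβ0 : 0 ≤ β := by positivity
  set γ := 2 * CP * 3 ^ dw * CV with hγ
  have hγ0 : 0 ≤ γ := by positivity
  set q := (2 : ℝ) ^ (-((s - (df - dw)) / 2)) with hq
  have hq0 : 0 < q := by positivity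
  have hq1 : q < 1 := Real.rpow_lt_one_of_one_lt_of_neg one_lt_two (by linarith)
  have hq1' : 0 < 1 - q := by linarith
  -- The three terms account for the chain of halved balls, the last edge and the passage to the
  -- ball of radius 3r. With a = 1/(4Q) the increments add up to less than 1/4. The summand 1 keeps
  -- Q positive.
  set Q := √α * (1 - q)⁻¹ + √β + √γ + 1 with hQ
  have hQ0 : 0 < Q := by positivity
  set a := 1 / (4 * Q) with ha
  have ha0 : 0 < a := by positivity
  refine ⟨a ^ 2, by positivity, ?_⟩
  intro V W hP hV hPI x r hr u hu v₀ hx y hy hhalf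
  by_contra! hcon
  obtain ⟨htot, hloc⟩ := hcon
  have hr0 : 0 < r := by linarith
  obtain ⟨e, t, ht, hyt, hyv⟩ := exists_dist_vtx_src_le y
  set v := src e with hv
  set f : V → ℝ := fun v => u (W.vtx v) with hf
  -- With 2^N ≤ r < 2^(N+1), the radii r/2^k are at least 1 for k ≤ N, and the ball of radius
  -- r/2^(N+1) < 1 is the single vertex v.
  obtain ⟨N, hN1, hN2⟩ := exists_nat_pow_near (show 1 ≤ r by linarith) one_lt_two
  set ρ : ℕ → ℝ := fun k => r / 2 ^ k with hρ
  have hρ0 : ∀ k, 0 < ρ k := fun k => by positivity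
  have hρr : ∀ k, ρ k ≤ r := fun k => div_le_self hr0.le (one_le_pow₀ one_le_two)
  have hρ1 : ∀ k ≤ N, 1 ≤ ρ k := fun k hk => by
    rw [hρ, one_le_div (by positivity)]
    exact (pow_le_pow_right₀ one_le_two hk).trans hN1
  have hρhalf : ∀ k, ρ k / 2 = ρ (k + 1) := fun k => by
    simp only [hρ, pow_succ]; field_simp
  have hρdiv : ∀ k, ρ k / r = (2 ^ k)⁻¹ := fun k => by
    simp only [hρ]; field_simp
  have hρlast : ρ (N + 1) < 1 := by
    simp only [hρ]; rwa [div_lt_one (by positivity)]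
  have hball : ∀ k, Metric.closedBall y (4 * ρ k) ⊆ Metric.ball x (9 * r) := fun k =>
    Metric.closedBall_subset_ball' (by linarith [hρr k])
  have hen : ∀ k ≤ N, (energyOn (Metric.closedBall y (4 * ρ k)) u).toReal ≤
      a ^ 2 * (ρ k / r) ^ s * r ^ (df - dw) := fun k hk => (hloc (ρ k) (hρ1 k hk) (hρr k)).le
  -- This isolates the factor ρ^(df-dw), which cancels the Poincaré factor ρ^(dw-df) and leaves the
  -- decay (ρ/r)^(s-(df-dw)).
  have hexp : ∀ k, (ρ k / r) ^ s * r ^ (df - dw) =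
      (ρ k / r) ^ (s - (df - dw)) * ρ k ^ (df - dw) := fun k => by
    rw [Real.rpow_sub (div_pos (hρ0 k) hr0), Real.div_rpow (hρ0 k).le hr0.le (df - dw)]
    have := Real.rpow_pos_of_pos (hρ0 k) (df - dw)
    have := Real.rpow_pos_of_pos hr0 (df - dw)
    field_simp
  have hchain : ∀ k ∈ Finset.range (N + 1),
      |W.graphMean f v (ρ (k + 1)) - W.graphMean f v (ρ k)| ≤ √α * a * q ^ k := by
    intro k hk
    have hkN : k ≤ N := Nat.lt_succ_iff.1 (Finset.mem_range.1 hk)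
    have h := sq_graphMean_half_sub_le hp₀ hCV hCP hP hV hPI hu hyv (hρ1 k hkN) (hball k)
    rw [hρhalf, ← hα] at h
    rw [mul_assoc]
    refine abs_le_sqrt_mul hα0 (by positivity) (h.trans ?_)
    have h2 := mul_le_mul_of_nonneg_left (hen k hkN)
      (mul_nonneg hα0 (Real.rpow_nonneg (hρ0 k).le (dw - df)))
    refine h2.trans (le_of_eq ?_)
    rw [mul_assoc (a ^ 2), hexp, hρdiv, inv_two_pow_rpow, ← hq, ← neg_sub df dw,
      Real.rpow_neg (hρ0 k).le]
    have := Real.rpow_pos_of_pos (hρ0 k) (df - dw)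
    field_simp
  have hsum : |W.graphMean f v (ρ (N + 1)) - W.graphMean f v (ρ 0)| ≤ √α * a * (1 - q)⁻¹ := by
    rw [← Finset.sum_range_sub (fun k => W.graphMean f v (ρ k))]
    refine (Finset.abs_sum_le_sum_abs _ _).trans ((Finset.sum_le_sum hchain).trans ?_)
    rw [← Finset.mul_sum]
    gcongr
    rw [← tsum_geometric_of_lt_one hq0.le hq1]
    exact (summable_geometric_of_lt_one hq0.le hq1).sum_le_tsum _ fun k _ => by positivity
  have hedge : |u y - W.graphMean f v (ρ (N + 1))| ≤ √β * a := by
    rw [graphMean_of_lt_one f v (hρ0 _).le hρlast]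
    refine abs_le_sqrt_mul hβ0 ha0.le ?_
    have hseg : ∀ s ∈ Icc 0 t, edgePath e s ∈ Metric.closedBall y (4 * ρ N) := fun s hs => by
      rw [Metric.mem_closedBall, ← hyt]
      refine (dist_edgePath_le e s t).trans ?_
      rw [abs_le]
      constructor <;> linarith [hs.1, hs.2, ht.2, hρ1 N le_rfl]
    have h := hu.sq_sub_mul_weight_le Metric.isClosed_closedBall.measurableSet
      (hu.energyOn_ne_top (hball N)) e le_rfl ht.1 ht.2 (fun s hs => hball N (hseg s hs)) hseg
    rw [hyt, edgePath_zero, ← hv, sub_zero] at h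
    have hw := le_weight hV hCV hp₀ hP e
    rw [← hω] at hw
    rw [hβ, div_mul_eq_mul_div, le_div_iff₀ hω0]
    calc (u y - f v) ^ 2 * ω ≤ (u y - u (W.vtx v)) ^ 2 * W.weight v (tgt e) := by gcongr
      _ ≤ t * (energyOn (Metric.closedBall y (4 * ρ N)) u).toReal := h
      _ ≤ 1 * (a ^ 2 * ((ρ N / r) ^ (s - (df - dw)) * ρ N ^ (df - dw))) := by
          rw [← hexp, ← mul_assoc (a ^ 2)]
          exact mul_le_mul ht.2 (hen N le_rfl) ENNReal.toReal_nonneg zero_le_one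
      _ ≤ 1 * (a ^ 2 * (1 * 2 ^ |df - dw|)) := by
          have h1 : (ρ N / r) ^ (s - (df - dw)) ≤ 1 :=
            Real.rpow_le_one (div_pos (hρ0 N) hr0).le ((div_le_one hr0).2 (hρr N)) (by linarith)
          have h2 : ρ N ^ (df - dw) ≤ 2 ^ |df - dw| :=
            rpow_le_two_rpow_abs (hρ1 N le_rfl) (by linarith [hρhalf N])
          have := Real.rpow_nonneg (hρ0 N).le (df - dw)
          gcongr
      _ = _ := by ring
  have hfirst : |W.graphMean f v (ρ 0) - W.graphMean f v₀ (3 * r)| ≤ √γ * a := by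
    have hρz : ρ 0 = r := by simp [hρ]
    rw [hρz]
    refine abs_le_sqrt_mul hγ0 ha0.le ?_
    refine (sq_graphMean_sub_graphMean_three_mul_le hCV hCP hV hPI hr hu hx hyv hy).trans ?_
    rw [← hγ]
    refine (mul_le_mul_of_nonneg_left htot.le
      (mul_nonneg hγ0 (Real.rpow_nonneg hr0.le (dw - df)))).trans (le_of_eq ?_)
    rw [← neg_sub df dw, Real.rpow_neg hr0.le]
    have := Real.rpow_pos_of_pos hr0 (df - dw)
    field_simp
  have h1 := abs_sub_le (u y) (W.graphMean f v (ρ (N + 1))) (W.graphMean f v₀ (3 * r))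
  have h2 := abs_sub_le (W.graphMean f v (ρ (N + 1))) (W.graphMean f v (ρ 0))
    (W.graphMean f v₀ (3 * r))
  have h3 : Q * a = 1 / 4 := by rw [ha]; field_simp
  have h4 : √α * a * (1 - q)⁻¹ + √β * a + √γ * a = Q * a - a := by rw [hQ]; ring
  linarith

/-! ### Large scales -/

theorem mul_rpow_le_energyOn {V : Type u} {W : WeightedGraph V} {s τ c lam r : ℝ} (hc : 0 < c)
    (hr : 0 < r) {x : W.Cable} {u : W.Cable → ℝ}
    (hu : IsInReflectedDomain (Metric.ball x (9 * r)) u) {A : Set W.Cable}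
    (hA : A ⊆ Metric.ball x r)
    (hcont : ENNReal.ofReal (lam * r ^ s) ≤ hausdorffContent s A)
    (hpt : ∀ y ∈ A, ∃ ρ : ℝ, 1 ≤ ρ ∧ ρ ≤ r ∧
      c * (ρ / r) ^ s * r ^ τ ≤ (energyOn (Metric.closedBall y (4 * ρ)) u).toReal) :
    lam * c / 21 ^ s * r ^ τ ≤ (energyOn (Metric.ball x (9 * r)) u).toReal := by
  choose! ρ hρ1 hρr hρ using hpt
  set g : W.Cable → ENNReal := fun y => ENNReal.ofReal (gradNorm u y ^ 2) with hg
  -- The energy measure of u on the large ball: finite, and equal to the energy on each of the small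
  -- balls, which lie inside.
  set ν : Measure W.Cable := (W.cableMeasure.restrict (Metric.ball x (9 * r))).withDensity g with hν
  have huniv : ν univ = energyOn (Metric.ball x (9 * r)) u := by
    rw [hν, withDensity_apply _ MeasurableSet.univ, Measure.restrict_univ]; rfl
  have hfin := hu.energyOn_ne_top subset_rfl
  have : IsFiniteMeasure ν := ⟨by rw [huniv]; exact hfin.lt_top⟩
  have : Nonempty W.Cable := ⟨x⟩
  have hball : ∀ y ∈ A, Metric.closedBall y (4 * ρ y) ⊆ Metric.ball x (9 * r) := fun y hy =>
    Metric.closedBall_subset_ball' (by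
      have := Metric.mem_ball.1 (hA hy)
      linarith [hρr y hy])
  have hνball : ∀ y ∈ A, ν (Metric.closedBall y (4 * ρ y)) =
      energyOn (Metric.closedBall y (4 * ρ y)) u := fun y hy => by
    rw [hν, withDensity_apply _ Metric.isClosed_closedBall.measurableSet,
      Measure.restrict_restrict Metric.isClosed_closedBall.measurableSet,
      inter_eq_left.2 (hball y hy)]
    rfl
  set κ := c * r ^ τ / r ^ s with hκ
  have hκ0 : 0 < κ := by positivity
  have h := hausdorffContent_le_mul_measure_univ ν (s := s) (R := r) hκ0 (A := A) (ρ := ρ)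
    (fun y hy => by linarith [hρ1 y hy]) hρr (fun y hy => by
      rw [hνball y hy]
      refine ENNReal.ofReal_le_of_le_toReal (le_trans (le_of_eq ?_) (hρ y hy))
      rw [Real.div_rpow (by linarith [hρ1 y hy]) hr.le, hκ]
      field_simp)
  have h2 := hcont.trans h
  rw [huniv, ← ENNReal.ofReal_toReal hfin, ← ENNReal.ofReal_mul (by positivity),
    ENNReal.ofReal_le_ofReal_iff (by positivity)] at h2
  rw [hκ] at h2
  have h21 : (0 : ℝ) < 21 ^ s := by positivity
  have hrs : 0 < r ^ s := by positivity
  have hrt : 0 < r ^ τ := by positivity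
  rw [div_mul_eq_mul_div, div_le_iff₀ h21]
  have h3 : 21 ^ s / (c * r ^ τ / r ^ s) * (energyOn (Metric.ball x (9 * r)) u).toReal =
      21 ^ s * (energyOn (Metric.ball x (9 * r)) u).toReal * r ^ s / (c * r ^ τ) := by
    field_simp
  rw [h3, le_div_iff₀ (by positivity)] at h2
  refine le_of_mul_le_mul_right ?_ hrs
  linarith

end WeightedGraph

open WeightedGraph in
theorem proposition3p2 (p₀ CV CP s df dw lam : ℝ) (hp₀ : 0 < p₀) (hCV : 1 < CV) (hCP : 1 < CP)
    (hdw : dw ≤ df + 1) (hs : df - dw < s) (hs' : s ≤ df) (hlam : 0 < lam) :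
    ∃ C : ℝ, 1 < C ∧
      ∀ (V : Type u) (W : WeightedGraph V),
        W.SatisfiesP0 p₀ → W.SatisfiesVolumeGrowth df CV → W.SatisfiesPoincare dw CP →
        ∀ (x : W.Cable) (r : ℝ), 0 < r →
        ∀ E F : Set W.Cable, E ⊆ Metric.ball x r → F ⊆ Metric.ball x r → Disjoint E F →
        ENNReal.ofReal (lam * r ^ s) ≤ min (hausdorffContent s E) (hausdorffContent s F) →
        ∀ u : W.Cable → ℝ, WeightedGraph.IsInReflectedDomain (Metric.ball x (9 * r)) u →
          (∀ y ∈ E, u y = 1) → (∀ y ∈ F, u y = 0) →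
          ENNReal.ofReal (C⁻¹ * r ^ (df - dw)) ≤
            ∫⁻ y in Metric.ball x (9 * r), ENNReal.ofReal (WeightedGraph.gradNorm u y ^ 2)
              ∂W.cableMeasure := by
  obtain ⟨c, hc, hdich⟩ := exists_energyOn_closedBall_ge.{u} (p₀ := p₀) (df := df) (dw := dw)
    hp₀ hCV hCP hs
  have hCV0 : 0 < CV := by linarith
  set ω := p₀ * (CV⁻¹ / (1 + p₀⁻¹)) with hω
  have hω0 : 0 < ω := by positivity
  -- The three entries serve large total energy, the covering argument and small radii,
  -- respectively. C = 1 + b⁻¹ exceeds 1 and satisfies C⁻¹ ≤ b.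
  set b := min c (min (lam * c / 21 ^ s) (ω / (36 * 2 ^ (df - dw + 1)))) with hb
  have hb0 : 0 < b := lt_min hc (lt_min (by positivity) (by positivity))
  refine ⟨1 + b⁻¹, by linarith [inv_pos.2 hb0], ?_⟩
  intro V W hP hV hPI x r hr E F hE hF _ hcont u hu hu1 hu0
  have hfin := hu.energyOn_ne_top subset_rfl
  refine ENNReal.ofReal_le_of_le_toReal ?_
  change _ ≤ (energyOn (Metric.ball x (9 * r)) u).toReal
  suffices b * r ^ (df - dw) ≤ (energyOn (Metric.ball x (9 * r)) u).toReal by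
    refine le_trans ?_ this
    gcongr
    exact inv_le_of_inv_le₀ hb0 (by linarith)
  have hrτ : 0 < r ^ (df - dw) := by positivity
  rcases le_or_gt r 2 with hr2 | hr2
  · have : Nonempty W.Cable := ⟨x⟩
    have hpos : (0 : ENNReal) < ENNReal.ofReal (lam * r ^ s) := ENNReal.ofReal_pos.2 (by positivity)
    obtain ⟨y, hy⟩ := nonempty_of_hausdorffContent_pos
      (hpos.trans_le (hcont.trans (min_le_left _ _)))
    obtain ⟨z, hz⟩ := nonempty_of_hausdorffContent_pos
      (hpos.trans_le (hcont.trans (min_le_right _ _)))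
    have h := hu.le_mul_energyOn hr hr2 hω0 (le_weight hV hCV hp₀ hP) (hE hy) (hF hz)
      (hu1 y hy) (hu0 z hz)
    -- This is where dw ≤ df + 1 enters: the exponent df - dw + 1 is nonnegative, so the power stays
    -- bounded as r tends to 0.
    have h1 : r ^ (df - dw) * r ≤ 2 ^ (df - dw + 1) := by
      rw [← Real.rpow_add_one hr.ne']
      exact Real.rpow_le_rpow hr.le hr2 (by linarith)
    have h2 : b * (36 * 2 ^ (df - dw + 1)) ≤ ω := by
      rw [← le_div_iff₀ (by positivity)]
      exact (min_le_right _ _).trans (min_le_right _ _)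
    have h3 : b * (36 * (r ^ (df - dw) * r)) ≤ b * (36 * 2 ^ (df - dw + 1)) := by gcongr
    refine le_of_mul_le_mul_right ?_ hr
    linarith
  · obtain ⟨e, -, -, -, hv₀⟩ := exists_dist_vtx_src_le x
    set M := W.graphMean (fun v => u (W.vtx v)) (src e) (3 * r) with hM
    by_cases htot : c * r ^ (df - dw) ≤ (energyOn (Metric.ball x (9 * r)) u).toReal
    · refine le_trans ?_ htot
      gcongr
      exact min_le_left _ _
    -- M cannot be within less than 1/2 of both values 0 and 1. Choose E if M ≤ 1/2 and F otherwise.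
    have hA : ∃ A ⊆ Metric.ball x r, ENNReal.ofReal (lam * r ^ s) ≤ hausdorffContent s A ∧
        ∀ y ∈ A, 1 / 2 ≤ |u y - M| := by
      rcases le_total M (1 / 2) with h | h
      · refine ⟨E, hE, hcont.trans (min_le_left _ _), fun y hy => ?_⟩
        rw [hu1 y hy]
        exact le_trans (by linarith) (le_abs_self _)
      · refine ⟨F, hF, hcont.trans (min_le_right _ _), fun y hy => ?_⟩
        rw [hu0 y hy]
        exact le_trans (by linarith) (neg_le_abs _)
    obtain ⟨A, hAx, hAc, hAM⟩ := hA
    refine le_trans ?_ (mul_rpow_le_energyOn hc hr hu hAx hAc (τ := df - dw) fun y hy =>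
      (hdich V W hP hV hPI x r hr2.le u hu (src e) hv₀ y (hAx hy) (hAM y hy)).resolve_left htot)
    gcongr
    exact (min_le_right _ _).trans (min_le_left _ _)
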